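/- Let $\mathcal H$ be a complex Hilbert space, $M\ge 1$, $\hbar>0$, let $H$ be any self-adjoint (possibly unbounded) Hamiltonian on the Hilbert tensor power $\mathcal H^{\otimes M}$, and let $U(t)=e^{-\mathrm iHt/\hbar}$. Let $\Lambda$ be a set of pointer positions and $G(y)$, $y\in\Lambda$, bounded operators on $\mathcal H$ (the single-particle reduction operators). Let $G(k,y)=I^{\otimes(k-1)}\otimes G(y)\otimes I^{\otimes(M-k)}$ and $G(k,r,y)=U(r)^\dagger G(k,y)U(r)$. A trajectory $\upsilon=((t_1,y_1),(t_2,y_2),\dots)$ consists of scattering times $0\le t_1<t_2<\dots$, only finitely many of them before any given time, and of marks $y_n\in\Lambda$; put $\tau_t=\{t_n: t_n<t\}$ and $n_t=|\tau_t|$. For a partition $\tau_t=\sigma_1\sqcup\dots\sqcup\sigma_M$ into labelled, possibly empty parts let $k_n$ be the index with $t_n\in\sigma_{k_n}$, and let $F_t(\sigma)=G(k_1,t_1,y_1)^\dagger G(k_2,t_2,y_2)^\dagger\cdots G(k_{n_t},t_{n_t},y_{n_t})^\dagger$. Put $$\Phi_t[X]=\frac1{M^{n_t}}\sum_{\sigma_1\sqcup\dots\sqcup\sigma_M=\tau_t}F_t(\sigma)\,X\,F_t(\sigma)^\dagger,\qquad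 \Theta_t[X]=\Phi_t[U(t)^\dagger XU(t)]$$ for bounded $X$, and for a density operator $\rho_0$ (positive, of trace one) on $\mathcal H^{\otimes M}$ define the a posteriori density operator along $\upsilon$, with $T_t(\sigma)=U(t)F_t(\sigma)^\dagger$, by $$\rho(t)=\frac1{M^{n_t}}\sum_{\sigma_1\sqcup\dots\sqcup\sigma_M=\tau_t}T_t(\sigma)\,\rho_0\,T_t(\sigma)^\dagger .$$ Then for every trajectory $\upsilon$ and every $\rho_0$: 1. For all $t\ge0$, $\rho(t)$ is a positive trace class operator, and $\operatorname{Tr}\{X\rho(t)\}=\operatorname{Tr}\{\Theta_t[X]\rho_0\}$ for all bounded $X$. 2. $\Phi_t=\Psi(t_1,y_1)\circ\Psi(t_2,y_2)\circ\dots\circ\Psi(t_{n_t},y_{n_t})$ for all $t\ge 0$, where $\Psi(r,y)[X]=\frac1M\sum_{k=1}^M G(k,r,y)^\dagger XG(k,r,y)$. 3. $\rho$ is a solution of the forward (Itô) equation $$\mathrm d\rho(t)+\frac{\mathrm i}{\hbar}[H,\rho(t)]\,\mathrm dt=\mathrm dn_t\Bigl(\frac1M\sum_{k=1}^MG(k)\rho(t)G(k)^\dagger-\rho(t)\Bigr),\qquad\rho(0)=\rho_0,$$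 and every solution with values in the bounded operators equals $\rho(t)$ for all $t\ge0$. Here a solution is a function with $\rho(0)=\rho_0$ such that for all $\varphi,\psi$ in the domain of $H$ and all $t\ge0$ the function $s\mapsto\langle H\varphi,\rho(s)\psi\rangle-\langle\varphi,\rho(s)H\psi\rangle$ is integrable on $[0,t]$ and $$\langle\varphi,\rho(t)\psi\rangle-\langle\varphi,\rho_0\psi\rangle+\frac{\mathrm i}\hbar\int_0^t\bigl(\langle H\varphi,\rho(s)\psi\rangle-\langle\varphi,\rho(s)H\psi\rangle\bigr)\mathrm ds=\sum_{t_n<t}\Bigl\langle\varphi,\Bigl(\frac1M\sum_{k=1}^MG(k,y_n)\rho(t_n)G(k,y_n)^\dagger-\rho(t_n)\Bigr)\psi\Bigr\rangle .$$ 4. A function is a solution in this sense if and only if it satisfies, for all $t\ge0$, the integral equation $$\rho(t)=U(t)\rho_0U(t)^\dagger+\sum_{t_n<t}U(t-t_n)\Bigl(\frac1M\sum_{k=1}^MG(k,y_n)\rho(t_n)G(k,y_n)^\dagger-\rho(t_n)\Bigr)U(t-t_n)^\dagger .$$ -/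

import Mathlib

open scoped InnerProductSpace ComplexConjugate

noncomputable section

namespace MixingReduction

/-! ### The Hilbert tensor power `E ⊗ ⋯ ⊗ E` (`M` factors) -/

section TensorPower

open scoped ComplexOrder

variable {M : ℕ} {E : Type*} [NormedAddCommGroup E] [InnerProductSpace ℂ E]

/-- The kernel `⟪x, y⟫ = ∏ₖ ⟪xₖ, yₖ⟫` on `M`-tuples of vectors. -/
def tupleKernel (M : ℕ) (E : Type*) [NormedAddCommGroup E] [InnerProductSpace ℂ E] :
    Matrix (Fin M → E) (Fin M → E) ℂ :=
  Matrix.of fun x y => ∏ k, ⟪x k, y k⟫_ℂ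

theorem finsupp_gram_eq {ι F : Type*} [NormedAddCommGroup F] [InnerProductSpace ℂ F]
    (v : ι → F) (c : ι →₀ ℂ) :
    (c.sum fun i a => c.sum fun j b => star a * ⟪v i, v j⟫_ℂ * b)
      = ⟪c.sum fun i a => a • v i, c.sum fun i a => a • v i⟫_ℂ := by
  simp only [Finsupp.sum, sum_inner, inner_sum, inner_smul_left, inner_smul_right,
    Finset.mul_sum]
  rw [Finset.sum_comm]
  refine Finset.sum_congr rfl fun i _ => Finset.sum_congr rfl fun j _ => ?_
  simp only [RCLike.star_def]
  ring

theorem inner_self_eq_ofReal {F : Type*} [SeminormedAddCommGroup F] [InnerProductSpace ℂ F]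
    (v : F) : ⟪v, v⟫_ℂ = ((‖v‖ ^ 2 : ℝ) : ℂ) := by
  rw [inner_self_eq_norm_sq_to_K]
  simp

theorem posSemidef_inner {ι F : Type*} [NormedAddCommGroup F] [InnerProductSpace ℂ F]
    (v : ι → F) : (Matrix.of fun i j => ⟪v i, v j⟫_ℂ : Matrix ι ι ℂ).PosSemidef := by
  refine ⟨Matrix.ext fun i j => ?_, fun c => ?_⟩
  · simp
  · simp only [Matrix.of_apply]
    rw [finsupp_gram_eq, Complex.le_def]
    exact ⟨inner_self_nonneg (𝕜 := ℂ), (inner_self_im (𝕜 := ℂ) _).symm⟩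

theorem posSemidef_prod {ι κ : Type*} (s : Finset κ) (B : κ → Matrix ι ι ℂ)
    (hB : ∀ k ∈ s, (B k).PosSemidef) :
    (Matrix.of fun i j => ∏ k ∈ s, B k i j : Matrix ι ι ℂ).PosSemidef := by
  classical
  induction s using Finset.induction_on with
  | empty =>
    have h := posSemidef_inner (fun _ : ι => (1 : ℂ))
    simpa using h
  | insert k s hk ih =>
    have h1 := hB k (Finset.mem_insert_self k s)
    have h2 := ih fun l hl => hB l (Finset.mem_insert_of_mem hl)
    have h3 := h1.hadamard h2
    have h4 : (Matrix.of fun i j => ∏ l ∈ insert k s, B l i j : Matrix ι ι ℂ)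
        = (B k).hadamard (Matrix.of fun i j => ∏ l ∈ s, B l i j) := by
      ext i j
      simp [Finset.prod_insert hk, Matrix.hadamard_apply]
    exact h4 ▸ h3

theorem posSemidef_tupleKernel : (tupleKernel M E).PosSemidef :=
  posSemidef_prod Finset.univ (fun k => Matrix.of fun x y : Fin M → E => ⟪x k, y k⟫_ℂ)
    fun k _ => posSemidef_inner fun x : Fin M → E => x k

/-- Formal linear combinations of `M`-tuples of vectors, with the semi-inner product determined
by `⟪x, y⟫ = ∏ₖ ⟪xₖ, yₖ⟫` on tuples. -/
def FormalTensor (M : ℕ) (E : Type*) [NormedAddCommGroup E] [InnerProductSpace ℂ E] : Type _ :=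
  (Fin M → E) →₀ ℂ

instance : AddCommGroup (FormalTensor M E) := inferInstanceAs (AddCommGroup ((Fin M → E) →₀ ℂ))

instance : Module ℂ (FormalTensor M E) := inferInstanceAs (Module ℂ ((Fin M → E) →₀ ℂ))

/-- The formal combination `f`, seen as a finitely supported function. -/
def FormalTensor.coeffs (f : FormalTensor M E) : (Fin M → E) →₀ ℂ := f

instance instCore : PreInnerProductSpace.Core ℂ (FormalTensor M E) where
  inner f g := f.coeffs.sum fun x a => g.coeffs.sum fun y b => star a * tupleKernel M E x y * b
  conj_inner_symm f g := by
    rw [Finsupp.sum_comm]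
    simp only [map_finsuppSum]
    refine Finsupp.sum_congr fun x _ => Finsupp.sum_congr fun y _ => ?_
    rw [← (posSemidef_tupleKernel (M := M) (E := E)).isHermitian.apply x y]
    simp
    ring
  add_left f g h := by
    refine Finsupp.sum_add_index' (f := f.coeffs) (g := g.coeffs) ?_ ?_
    · simp
    · intro x a b
      simp [← Finsupp.sum_add, add_mul]
  smul_left f g r := by
    refine (Finsupp.sum_smul_index (g := f.coeffs) (b := r) ?_).trans ?_
    · simp
    · simp [Finsupp.mul_sum, ← mul_assoc]
  re_inner_nonneg f := by
    have h := (posSemidef_tupleKernel (M := M) (E := E)).2 f.coeffs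
    exact (Complex.le_def.1 h).1

instance : SeminormedAddCommGroup (FormalTensor M E) :=
  InnerProductSpace.Core.toSeminormedAddCommGroup (𝕜 := ℂ)

instance : InnerProductSpace ℂ (FormalTensor M E) := .ofCore _

theorem formal_inner_def (f g : FormalTensor M E) :
    ⟪f, g⟫_ℂ = f.coeffs.sum fun x a => g.coeffs.sum fun y b => star a * tupleKernel M E x y * b :=
  rfl

/-- The `M`-fold Hilbert tensor power of `E`: the (Hausdorff) completion of the formal linear
combinations of `M`-tuples for the inner product `⟪⊗ₖ xₖ, ⊗ₖ yₖ⟫ = ∏ₖ ⟪xₖ, yₖ⟫`. -/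
abbrev TensorPower (M : ℕ) (E : Type*) [NormedAddCommGroup E] [InnerProductSpace ℂ E] : Type _ :=
  UniformSpace.Completion (FormalTensor M E)

/-- The formal tuple `x₁ ⊗ ⋯ ⊗ x_M`. -/
def FormalTensor.of (x : Fin M → E) : FormalTensor M E := Finsupp.single x (1 : ℂ)

/-- The product vector `x₁ ⊗ ⋯ ⊗ x_M`. -/
def tprod (x : Fin M → E) : TensorPower M E := (FormalTensor.of x : FormalTensor M E)

theorem inner_tprod (x y : Fin M → E) : ⟪tprod x, tprod y⟫_ℂ = ∏ k, ⟪x k, y k⟫_ℂ := by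
  rw [tprod, tprod, UniformSpace.Completion.inner_coe, formal_inner_def]
  simp [FormalTensor.of, FormalTensor.coeffs, tupleKernel]

theorem dense_span_tprod :
    Dense (Submodule.span ℂ (Set.range (tprod : (Fin M → E) → TensorPower M E)) :
      Set (TensorPower M E)) := by
  refine UniformSpace.Completion.denseRange_coe.mono ?_
  rintro _ ⟨f, rfl⟩
  induction f using Finsupp.induction_linear with
  | zero => exact Submodule.zero_mem _
  | add f g hf hg =>
    have h : ((show FormalTensor M E from f + g : FormalTensor M E) : TensorPower M E)
        = (show FormalTensor M E from f) + (show FormalTensor M E from g) :=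
      UniformSpace.Completion.coe_add (α := FormalTensor M E) f g
    exact h ▸ Submodule.add_mem _ hf hg
  | single x a =>
    have h : (Finsupp.single x a : (Fin M → E) →₀ ℂ) = a • (Finsupp.single x (1 : ℂ)) := by simp
    have h' : ((show FormalTensor M E from Finsupp.single x a : FormalTensor M E) :
        TensorPower M E) = a • tprod x := by
      rw [tprod, ← UniformSpace.Completion.coe_smul]
      exact congrArg _ h
    exact h' ▸ Submodule.smul_mem _ a (Submodule.subset_span ⟨x, rfl⟩)

/-- Applying `A` to the `k`-th vector of every tuple. -/
def formalSlot (k : Fin M) (A : E →L[ℂ] E) : FormalTensor M E →ₗ[ℂ] FormalTensor M E :=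
  Finsupp.lmapDomain ℂ ℂ fun x : Fin M → E => Function.update x k (A (x k))

theorem norm_formalSlot_le (k : Fin M) (A : E →L[ℂ] E) (f : FormalTensor M E) :
    ‖formalSlot k A f‖ ≤ ‖A‖ * ‖f‖ := by
  classical
  have hB : (Matrix.of fun x y : Fin M → E =>
      ((‖A‖ ^ 2 : ℝ) : ℂ) * ⟪x k, y k⟫_ℂ - ⟪A (x k), A (y k)⟫_ℂ).PosSemidef := by
    refine ⟨Matrix.ext fun x y => ?_, fun c => ?_⟩
    · simp [-Complex.ofReal_pow]
    · have h1 := finsupp_gram_eq (fun x : Fin M → E => x k) c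
      have h2 := finsupp_gram_eq (fun x : Fin M → E => A (x k)) c
      have h3 : (c.sum fun x a => a • A (x k)) = A (c.sum fun x a => a • x k) := by
        simp [Finsupp.sum]
      have h4 : (c.sum fun x a => c.sum fun y b => star a *
          ((((‖A‖ ^ 2 : ℝ) : ℂ)) * ⟪x k, y k⟫_ℂ - ⟪A (x k), A (y k)⟫_ℂ) * b)
          = ((‖A‖ ^ 2 : ℝ) : ℂ) * ⟪c.sum fun x a => a • x k, c.sum fun x a => a • x k⟫_ℂ
            - ⟪A (c.sum fun x a => a • x k), A (c.sum fun x a => a • x k)⟫_ℂ := by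
        rw [← h3, ← h1, ← h2]
        simp only [Finsupp.sum, Finset.mul_sum, ← Finset.sum_sub_distrib]
        refine Finset.sum_congr rfl fun i _ => Finset.sum_congr rfl fun j _ => ?_
        ring
      simp only [Matrix.of_apply]
      rw [h4, inner_self_eq_ofReal, inner_self_eq_ofReal]
      have h5 := A.le_opNorm (c.sum fun x a => a • x k)
      have h6 : ‖A (c.sum fun x a => a • x k)‖ ^ 2
          ≤ ‖A‖ ^ 2 * ‖c.sum fun x a => a • x k‖ ^ 2 := by
        rw [← mul_pow]
        exact pow_le_pow_left₀ (norm_nonneg _) h5 2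
      have h7 : (0 : ℝ) ≤ ‖A‖ ^ 2 * ‖c.sum fun x a => a • x k‖ ^ 2
          - ‖A (c.sum fun x a => a • x k)‖ ^ 2 := by linarith
      exact_mod_cast h7
  have hC := hB.hadamard (posSemidef_prod (Finset.univ.erase k)
    (fun l => Matrix.of fun x y : Fin M → E => ⟪x l, y l⟫_ℂ)
    fun l _ => posSemidef_inner fun x : Fin M → E => x l)
  have hf := hC.2 f.coeffs
  have e1 : ⟪formalSlot k A f, formalSlot k A f⟫_ℂ
      = f.coeffs.sum fun x a => f.coeffs.sum fun y b => star a *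
        (⟪A (x k), A (y k)⟫_ℂ * ∏ l ∈ Finset.univ.erase k, ⟪x l, y l⟫_ℂ) * b := by
    rw [formal_inner_def]
    change (Finsupp.mapDomain _ f.coeffs).sum (fun x a => (Finsupp.mapDomain _ f.coeffs).sum
      fun y b => star a * tupleKernel M E x y * b) = _
    rw [Finsupp.sum_mapDomain_index (by simp) (by intro x a b; simp [← Finsupp.sum_add, add_mul])]
    refine Finsupp.sum_congr fun x _ => ?_
    rw [Finsupp.sum_mapDomain_index (by simp) (by intro y a b; simp [mul_add])]
    refine Finsupp.sum_congr fun y _ => ?_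
    rw [tupleKernel, Matrix.of_apply, ← Finset.mul_prod_erase _ _ (Finset.mem_univ k)]
    congr 2
    simp only [Function.update_self]
    congr 1
    refine Finset.prod_congr rfl fun l hl => ?_
    rw [Function.update_of_ne (Finset.ne_of_mem_erase hl),
      Function.update_of_ne (Finset.ne_of_mem_erase hl)]
  have e2 : ⟪f, f⟫_ℂ
      = f.coeffs.sum fun x a => f.coeffs.sum fun y b => star a *
        (⟪x k, y k⟫_ℂ * ∏ l ∈ Finset.univ.erase k, ⟪x l, y l⟫_ℂ) * b := by
    rw [formal_inner_def]
    refine Finsupp.sum_congr fun x _ => Finsupp.sum_congr fun y _ => ?_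
    rw [tupleKernel, Matrix.of_apply, ← Finset.mul_prod_erase _ _ (Finset.mem_univ k)]
  have e3 : (0 : ℂ) ≤ ((‖A‖ ^ 2 : ℝ) : ℂ) * ⟪f, f⟫_ℂ
      - ⟪formalSlot k A f, formalSlot k A f⟫_ℂ := by
    rw [e1, e2]
    refine hf.trans_eq ?_
    simp only [Finsupp.sum, Finset.mul_sum, ← Finset.sum_sub_distrib, Matrix.hadamard_apply,
      Matrix.of_apply]
    refine Finset.sum_congr rfl fun i _ => Finset.sum_congr rfl fun j _ => ?_
    ring
  rw [inner_self_eq_ofReal, inner_self_eq_ofReal] at e3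
  have e4 : (0 : ℝ) ≤ ‖A‖ ^ 2 * ‖f‖ ^ 2 - ‖formalSlot k A f‖ ^ 2 := by exact_mod_cast e3
  refine le_of_sq_le_sq ?_ (by positivity)
  rw [mul_pow]
  linarith

/-- The operator `I ⊗ ⋯ ⊗ A ⊗ ⋯ ⊗ I` on the tensor power, with `A` in the `k`-th place. -/
def slot (k : Fin M) (A : E →L[ℂ] E) : TensorPower M E →L[ℂ] TensorPower M E :=
  ((formalSlot k A).mkContinuous ‖A‖ (norm_formalSlot_le k A)).completion

theorem slot_tprod (k : Fin M) (A : E →L[ℂ] E) (x : Fin M → E) :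
    slot k A (tprod x) = tprod (Function.update x k (A (x k))) := by
  rw [slot, tprod, ContinuousLinearMap.completion_apply_coe]
  exact congrArg _ (Finsupp.mapDomain_single (a := x) (b := (1 : ℂ)))

end TensorPower

/-! ### Traces, density operators and Schrödinger groups -/

section Operators

variable {K : Type*} [NormedAddCommGroup K] [InnerProductSpace ℂ K]

/-- `Tr A = c`: in every orthonormal basis the diagonal of `A` is summable, with sum `c`. -/
def HasTrace (A : K →L[ℂ] K) (c : ℂ) : Prop :=
  ∀ (S : Set K) (b : HilbertBasis S ℂ K), HasSum (fun i => ⟪b i, A (b i)⟫_ℂ) c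

/-- A density operator: positive, of trace one. -/
def IsDensityOperator (A : K →L[ℂ] K) : Prop :=
  A.IsPositive ∧ HasTrace A 1

/-- `U(t) = exp(-i t H / ħ)`: the strongly continuous one-parameter unitary group whose
infinitesimal generator is `-(i/ħ) H`, with the full domain of the self-adjoint operator `H`. -/
structure IsSchrodingerGroup [CompleteSpace K] (ħ : ℝ) (H : K →ₗ.[ℂ] K) (U : ℝ → K →L[ℂ] K) :
    Prop where
  zero : U 0 = 1
  add : ∀ s t, U (s + t) = U s * U t
  unitary : ∀ t, U t ∈ unitary (K →L[ℂ] K)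
  continuous : ∀ x, Continuous fun t => U t x
  mem_domain_iff : ∀ x, x ∈ H.domain ↔ DifferentiableAt ℝ (fun t => U t x) 0
  hasDerivAt : ∀ x : H.domain,
    HasDerivAt (fun t => U t (x : K)) (-(Complex.I / (ħ : ℂ)) • H x) 0

theorem selfAdjoint_symm [CompleteSpace K] {H : K →ₗ.[ℂ] K} (hH : IsSelfAdjoint H)
    (x y : H.domain) : ⟪H x, (y : K)⟫_ℂ = ⟪(x : K), H y⟫_ℂ := by
  have h := LinearPMap.adjoint_isFormalAdjoint hH.dense_domain
  rw [LinearPMap.isSelfAdjoint_def.1 hH] at h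
  exact h x y

theorem selfAdjoint_mem [CompleteSpace K] {H : K →ₗ.[ℂ] K} (hH : IsSelfAdjoint H) (y w : K)
    (h : ∀ x : H.domain, ⟪w, (x : K)⟫_ℂ = ⟪y, H x⟫_ℂ) : ∃ hy : y ∈ H.domain, H ⟨y, hy⟩ = w := by
  have hy : y ∈ H.domain := by
    have := LinearPMap.mem_adjoint_domain_of_exists (T := H) y ⟨w, h⟩
    rwa [LinearPMap.isSelfAdjoint_def.1 hH] at this
  refine ⟨hy, hH.dense_domain.eq_of_inner_left ℂ fun x hx => ?_⟩
  rw [h ⟨x, hx⟩, selfAdjoint_symm hH ⟨y, hy⟩ ⟨x, hx⟩]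

theorem shift_bound [CompleteSpace K] {H : K →ₗ.[ℂ] K} (hH : IsSelfAdjoint H) (a : ℝ)
    (x : H.domain) : |a| * ‖(x : K)‖ ≤ ‖H x + (Complex.I * a) • (x : K)‖ := by
  rcases eq_or_ne (x : K) 0 with h0 | h0
  · simp [h0]
  have h1 : (⟪(x : K), H x⟫_ℂ).im = 0 := by
    have h := selfAdjoint_symm hH x x
    rw [← inner_conj_symm] at h
    exact Complex.conj_eq_iff_im.1 h
  have h2 : (⟪(x : K), H x + (Complex.I * a) • (x : K)⟫_ℂ).im = a * ‖(x : K)‖ ^ 2 := by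
    rw [inner_add_right, inner_smul_right, inner_self_eq_ofReal, Complex.add_im, h1]
    simp [-Complex.ofReal_pow]
  have h3 := (Complex.abs_im_le_norm _).trans
    (norm_inner_le_norm (𝕜 := ℂ) (x : K) (H x + (Complex.I * a) • (x : K)))
  rw [h2, abs_mul, abs_of_nonneg (sq_nonneg ‖(x : K)‖)] at h3
  have h4 : 0 < ‖(x : K)‖ := norm_pos_iff.2 h0
  nlinarith

theorem shift_surjective [CompleteSpace K] {H : K →ₗ.[ℂ] K} (hH : IsSelfAdjoint H) {a : ℝ}
    (ha : a ≠ 0) (y : K) : ∃ x : H.domain, H x + (Complex.I * a) • (x : K) = y := by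
  let L : H.domain →ₗ[ℂ] K := H.toFun + (Complex.I * (a : ℂ)) • H.domain.subtype
  have hL : ∀ x, L x = H x + (Complex.I * a) • (x : K) := fun x => rfl
  have hdense : (LinearMap.range L).topologicalClosure = ⊤ := by
    rw [Submodule.topologicalClosure_eq_top_iff, Submodule.eq_bot_iff]
    intro z hz
    rw [Submodule.mem_orthogonal'] at hz
    have h1 : ∀ x : H.domain, ⟪(Complex.I * (a : ℂ)) • z, (x : K)⟫_ℂ = ⟪z, H x⟫_ℂ := by
      intro x
      have h := hz (L x) ⟨x, rfl⟩
      rw [hL, inner_add_right, inner_smul_right] at h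
      rw [inner_smul_left]
      simp only [map_mul, Complex.conj_I, Complex.conj_ofReal]
      linear_combination -h
    obtain ⟨hz1, hz2⟩ := selfAdjoint_mem hH z _ h1
    have h2 := shift_bound hH (-a) ⟨z, hz1⟩
    rw [hz2] at h2
    have h3 : (Complex.I * (a : ℂ)) • z + (Complex.I * ((-a : ℝ) : ℂ)) • z = 0 := by
      rw [← add_smul]; simp
    simp only at h2
    rw [h3, norm_zero, abs_neg] at h2
    have h4 : 0 < |a| := abs_pos.2 ha
    have h5 : ‖z‖ ≤ 0 := by nlinarith [norm_nonneg z]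
    exact norm_le_zero_iff.1 h5
  have hy : y ∈ closure (LinearMap.range L : Set K) := by
    rw [← Submodule.topologicalClosure_coe, hdense]; trivial
  obtain ⟨u, hu, hlim⟩ := mem_closure_iff_seq_limit.1 hy
  choose x hx using hu
  have hcau : CauchySeq fun n => ((x n : H.domain) : K) := by
    have hc := hlim.cauchySeq
    rw [Metric.cauchySeq_iff'] at hc ⊢
    intro ε hε
    have h4 : 0 < |a| := abs_pos.2 ha
    obtain ⟨N, hN⟩ := hc (|a| * ε) (by positivity)
    refine ⟨N, fun n hn => ?_⟩
    have h1 := hN n hn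
    rw [dist_eq_norm, ← hx, ← hx, ← map_sub, hL] at h1
    have h2 := (shift_bound hH a (x n - x N)).trans_lt h1
    rw [dist_eq_norm]
    exact lt_of_mul_lt_mul_left h2 h4.le
  obtain ⟨z, hz⟩ := cauchySeq_tendsto_of_complete hcau
  have hlim2 : Filter.Tendsto (fun n => H (x n)) Filter.atTop
      (nhds (y - (Complex.I * (a : ℂ)) • z)) := by
    refine (hlim.sub (hz.const_smul (Complex.I * (a : ℂ)))).congr fun n => ?_
    rw [← hx, hL]; simp
  obtain ⟨hz1, hz2⟩ := selfAdjoint_mem hH z (y - (Complex.I * (a : ℂ)) • z) fun w => by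
    have t1 := hlim2.inner (𝕜 := ℂ) (tendsto_const_nhds (x := (w : K)))
    have t2 := hz.inner (𝕜 := ℂ) (tendsto_const_nhds (x := H w))
    refine tendsto_nhds_unique t1 (t2.congr fun n => ?_)
    exact (selfAdjoint_symm hH (x n) w).symm
  exact ⟨⟨z, hz1⟩, by rw [hz2]; simp⟩

theorem exists_resolvent [CompleteSpace K] {H : K →ₗ.[ℂ] K} (hH : IsSelfAdjoint H) {a : ℝ}
    (ha : a ≠ 0) : ∃ R : K →L[ℂ] K, (∀ y, |a| * ‖R y‖ ≤ ‖y‖) ∧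
      (∀ y, ∃ h : R y ∈ H.domain, H ⟨R y, h⟩ + (Complex.I * a) • R y = y) ∧
      ∀ x : H.domain, R (H x + (Complex.I * a) • (x : K)) = x := by
  choose f hf using shift_surjective hH ha
  have hinj : ∀ x y : H.domain, H x + (Complex.I * a) • (x : K) = H y + (Complex.I * a) • (y : K) →
      x = y := by
    intro x y h
    have h1 := shift_bound hH a (x - y)
    have h2 : H (x - y) + (Complex.I * a) • ((x - y : H.domain) : K) = 0 := by
      rw [LinearPMap.map_sub, Submodule.coe_sub, smul_sub]
      rw [← sub_eq_zero] at h
      rw [← h]; abel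
    rw [h2, norm_zero] at h1
    have h4 : 0 < |a| := abs_pos.2 ha
    have h5 : ‖((x - y : H.domain) : K)‖ ≤ 0 := by
      nlinarith [norm_nonneg ((x - y : H.domain) : K)]
    have h6 := norm_le_zero_iff.1 h5
    exact sub_eq_zero.1 (Subtype.ext h6)
  have hbound : ∀ y, |a| * ‖(f y : K)‖ ≤ ‖y‖ := fun y => by
    have h := shift_bound hH a (f y)
    rwa [hf] at h
  have h4 : 0 < |a| := abs_pos.2 ha
  let R₀ : K →ₗ[ℂ] K :=
    { toFun := fun y => (f y : K)
      map_add' := fun y z => by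
        have : f (y + z) = f y + f z := hinj _ _ (by
          rw [hf, LinearPMap.map_add, Submodule.coe_add, smul_add]
          nth_rewrite 1 [← hf y, ← hf z]
          abel)
        rw [this]; rfl
      map_smul' := fun c y => by
        have : f (c • y) = c • f y := hinj _ _ (by
          rw [hf, LinearPMap.map_smul, Submodule.coe_smul, smul_comm, ← smul_add, hf])
        rw [this]; rfl }
  refine ⟨R₀.mkContinuous |a|⁻¹ fun y => ?_, fun y => hbound y, fun y => ⟨(f y).2, hf y⟩,
    fun x => ?_⟩
  · rw [← div_eq_inv_mul, le_div_iff₀ h4, mul_comm]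
    exact hbound y
  · have : f (H x + (Complex.I * a) • (x : K)) = x := hinj _ _ (hf _)
    exact congrArg Subtype.val this

theorem exists_approximants [CompleteSpace K] {H : K →ₗ.[ℂ] K} (hH : IsSelfAdjoint H) :
    ∃ B : ℕ → K →L[ℂ] K, (∀ n, star (B n) = B n) ∧ (∀ n m, Commute (B n) (B m)) ∧
      ∀ x : H.domain, Filter.Tendsto (fun n => B n (x : K)) Filter.atTop (nhds (H x)) := by
  choose R hR1 hR2 hR3 using fun a : {a : ℝ // a ≠ 0} => exists_resolvent hH a.2
  have hcomm : ∀ a b, Commute (R a) (R b) := by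
    have key : ∀ a b : {a : ℝ // a ≠ 0}, R a - R b
        = (Complex.I * ((b : ℝ) - (a : ℝ) : ℂ)) • (R a * R b) := by
      intro a b
      ext y
      obtain ⟨hb, hb'⟩ := hR2 b y
      have h1 := hR3 a ⟨R b y, hb⟩
      have h2 : H ⟨R b y, hb⟩ = y - (Complex.I * (b : ℝ)) • R b y := eq_sub_of_add_eq hb'
      rw [h2] at h1
      have h3 : R a y - (Complex.I * ((b : ℝ) : ℂ)) • R a (R b y)
          + (Complex.I * ((a : ℝ) : ℂ)) • R a (R b y) = R b y := by
        simpa using h1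
      change R a y - R b y = (Complex.I * ((b : ℝ) - (a : ℝ) : ℂ)) • R a (R b y)
      generalize R a (R b y) = w at h3 ⊢
      rw [← h3]
      module
    intro a b
    rcases eq_or_ne a b with rfl | hab
    · exact Commute.refl _
    have h1 := key a b
    have h2 := key b a
    have h3 : (Complex.I * ((b : ℝ) - (a : ℝ) : ℂ)) • (R a * R b)
        = (Complex.I * ((b : ℝ) - (a : ℝ) : ℂ)) • (R b * R a) := by
      rw [← h1, ← neg_sub, h2, ← neg_smul]
      congr 1
      ring
    have h4 : (Complex.I * ((b : ℝ) - (a : ℝ) : ℂ)) ≠ 0 := by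
      refine mul_ne_zero Complex.I_ne_zero (sub_ne_zero.2 fun h => hab ?_)
      exact Subtype.ext (Complex.ofReal_injective h).symm
    exact smul_right_injective _ h4 h3
  have hstar : ∀ a b : {a : ℝ // a ≠ 0}, (b : ℝ) = -a → star (R a) = R b := by
    intro a b hab
    rw [ContinuousLinearMap.star_eq_adjoint]
    symm
    rw [ContinuousLinearMap.eq_adjoint_iff]
    intro y z
    obtain ⟨h1, h1'⟩ := hR2 b y
    obtain ⟨h2, h2'⟩ := hR2 a z
    have h3 := selfAdjoint_symm hH ⟨R b y, h1⟩ ⟨R a z, h2⟩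
    nth_rewrite 1 [← h2']
    nth_rewrite 2 [← h1']
    rw [inner_add_right, inner_add_left, inner_smul_left, inner_smul_right, h3, hab]
    simp
  let p : ℕ → {a : ℝ // a ≠ 0} := fun n => ⟨(n : ℝ) + 1, by positivity⟩
  let q : ℕ → {a : ℝ // a ≠ 0} := fun n => ⟨-((n : ℝ) + 1), by
    have : (n : ℝ) + 1 ≠ 0 := by positivity
    exact neg_ne_zero.2 this⟩
  have hp0 : Filter.Tendsto (fun n : ℕ => ((n : ℝ) + 1)⁻¹) Filter.atTop (nhds 0) := by
    simpa using tendsto_one_div_add_atTop_nhds_zero_nat (𝕜 := ℝ)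
  have hlimD : ∀ (r : ℕ → {a : ℝ // a ≠ 0}), (∀ n, |(r n : ℝ)| = (n : ℝ) + 1) → ∀ x : H.domain,
      Filter.Tendsto (fun n => (Complex.I * ((r n : ℝ) : ℂ)) • R (r n) (x : K)) Filter.atTop
        (nhds (x : K)) := by
    intro r hr x
    have h0 : Filter.Tendsto (fun n => R (r n) (H x)) Filter.atTop (nhds 0) := by
      rw [tendsto_zero_iff_norm_tendsto_zero]
      refine squeeze_zero (fun n => norm_nonneg _) (fun n => ?_)
        (by simpa using hp0.mul_const ‖H x‖)
      have h1 := hR1 (r n) (H x)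
      rw [hr] at h1
      rw [← div_eq_inv_mul, le_div_iff₀ (by positivity), mul_comm]
      exact h1
    have h2 := (tendsto_const_nhds (x := (x : K))).sub h0
    rw [sub_zero] at h2
    refine h2.congr fun n => ?_
    have h3 := hR3 (r n) x
    rw [map_add, map_smul] at h3
    rw [← eq_sub_iff_add_eq'.2 h3]
  have hbd : ∀ (r : ℕ → {a : ℝ // a ≠ 0}), ∀ n y,
      ‖(Complex.I * ((r n : ℝ) : ℂ)) • R (r n) y‖ ≤ ‖y‖ := by
    intro r n y
    rw [norm_smul]
    simpa using hR1 (r n) y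
  have hlim : ∀ (r : ℕ → {a : ℝ // a ≠ 0}), (∀ n, |(r n : ℝ)| = (n : ℝ) + 1) → ∀ y : K,
      Filter.Tendsto (fun n => (Complex.I * ((r n : ℝ) : ℂ)) • R (r n) y) Filter.atTop
        (nhds y) := by
    intro r hr y
    rw [Metric.tendsto_atTop]
    intro ε hε
    obtain ⟨d, hd, hdy⟩ := hH.dense_domain.exists_dist_lt y (show (0 : ℝ) < ε / 3 by positivity)
    obtain ⟨N, hN⟩ := Metric.tendsto_atTop.1 (hlimD r hr ⟨d, hd⟩) (ε / 3) (by positivity)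
    refine ⟨N, fun n hn => ?_⟩
    have h1 := hN n hn
    have h2 : dist ((Complex.I * ((r n : ℝ) : ℂ)) • R (r n) y)
        ((Complex.I * ((r n : ℝ) : ℂ)) • R (r n) d) ≤ dist y d := by
      rw [dist_eq_norm, dist_eq_norm, ← smul_sub, ← map_sub]
      exact hbd r n _
    have h3 := dist_triangle4 ((Complex.I * ((r n : ℝ) : ℂ)) • R (r n) y)
      ((Complex.I * ((r n : ℝ) : ℂ)) • R (r n) d) d y
    rw [dist_comm d y] at h3
    linarith
  have hpa : ∀ n, |(p n : ℝ)| = (n : ℝ) + 1 := fun n => abs_of_pos (by positivity)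
  have hqa : ∀ n, |(q n : ℝ)| = (n : ℝ) + 1 := fun n => by
    rw [← hpa]; exact abs_neg _
  refine ⟨fun n => ((((n : ℝ) + 1) ^ 2 / 2 : ℝ) : ℂ) • (R (p n) + R (q n)), fun n => ?_,
    fun n m => ?_, fun x => ?_⟩
  · have h1 : star (R (p n)) = R (q n) := hstar _ _ rfl
    have h2 : star (R (q n)) = R (p n) := hstar _ _ (by simp [p, q])
    rw [star_smul, star_add, h1, h2, add_comm (R (q n))]
    congr 1
    exact Complex.conj_ofReal _
  · refine Commute.smul_left (Commute.smul_right ?_ _) _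
    exact ((hcomm _ _).add_left (hcomm _ _)).add_right ((hcomm _ _).add_left (hcomm _ _))
  · have h1 := ((hlim p hpa (H x)).add (hlim q hqa (H x))).const_smul ((1 / 2 : ℝ) : ℂ)
    have h2 : (((1 / 2 : ℝ)) : ℂ) • (H x + H x) = H x := by
      rw [← two_smul ℂ, smul_smul]; norm_num
    rw [h2] at h1
    refine h1.congr fun n => ?_
    have h3 := hR3 (p n) x
    have h4 := hR3 (q n) x
    rw [map_add, map_smul] at h3 h4
    have h5 : R (p n) (H x) = (x : K) - (Complex.I * ((p n : ℝ) : ℂ)) • R (p n) x :=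
      eq_sub_of_add_eq h3
    have h6 : R (q n) (H x) = (x : K) - (Complex.I * ((q n : ℝ) : ℂ)) • R (q n) x :=
      eq_sub_of_add_eq h4
    have h7 : ((q n : ℝ) : ℂ) = -((p n : ℝ) : ℂ) := by simp [p, q]
    have h8 : ((p n : ℝ) : ℂ) = (n : ℂ) + 1 := by simp [p]
    rw [h5, h6, h7, h8]
    change _ = ((((n : ℝ) + 1) ^ 2 / 2 : ℝ) : ℂ) • (R (p n) (x : K) + R (q n) (x : K))
    push_cast
    have hI : Complex.I * Complex.I = -1 := Complex.I_mul_I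
    simp only [smul_sub, smul_add, smul_smul]
    have e1 : (1 / 2 : ℂ) * (Complex.I * ((n : ℂ) + 1) * (Complex.I * ((n : ℂ) + 1)))
        = -(((n : ℂ) + 1) ^ 2 / 2) := by linear_combination (((n : ℂ) + 1) ^ 2 / 2) * hI
    have e2 : (1 / 2 : ℂ) * (Complex.I * -((n : ℂ) + 1) * (Complex.I * -((n : ℂ) + 1)))
        = -(((n : ℂ) + 1) ^ 2 / 2) := by linear_combination (((n : ℂ) + 1) ^ 2 / 2) * hI
    simp only [mul_assoc] at e1 e2 ⊢
    rw [e1, e2]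
    module

theorem exists_group_of_approximants [CompleteSpace K] (D : Set K) (hD : Dense D) (A : K → K)
    (B : ℕ → K →L[ℂ] K) (hB : ∀ n, star (B n) = -B n) (hc : ∀ n m, Commute (B n) (B m))
    (hA : ∀ x ∈ D, Filter.Tendsto (fun n => B n x) Filter.atTop (nhds (A x))) :
    ∃ U : ℝ → K →L[ℂ] K, U 0 = 1 ∧ (∀ s t, U (s + t) = U s * U t) ∧
      (∀ t, U t ∈ unitary (K →L[ℂ] K)) ∧ (∀ x, Continuous fun t => U t x) ∧
      ∀ x ∈ D, HasDerivAt (fun t => U t x) (A x) 0 := by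
  let +nondep : NormedAlgebra ℚ (K →L[ℂ] K) := .restrictScalars ℚ ℂ _
  have hskew : ∀ (C : K →L[ℂ] K), star C = -C → ∀ t : ℝ,
      NormedSpace.exp (t • C) ∈ unitary (K →L[ℂ] K) := by
    intro C hC t
    refine NormedSpace.exp_mem_unitary_of_mem_skewAdjoint ?_
    rw [skewAdjoint.mem_iff, star_smul, hC]
    simp
  have hnorm : ∀ V ∈ unitary (K →L[ℂ] K), ∀ x, ‖V x‖ = ‖x‖ := fun V hV x =>
    ((ContinuousLinearMap.norm_map_iff_adjoint_comp_self V).2 (Unitary.mem_iff.1 hV).1) x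
  have hder : ∀ (C : K →L[ℂ] K) (x : K) (t : ℝ),
      HasDerivAt (fun s : ℝ => NormedSpace.exp (s • C) x) (NormedSpace.exp (t • C) (C x)) t := by
    intro C x t
    have h := hasDerivAt_exp_smul_const (𝕂 := ℝ) C t
    have h2 := (((ContinuousLinearMap.apply ℂ K x).restrictScalars ℝ).hasFDerivAt).comp_hasDerivAt
      t h
    exact h2
  have hest : ∀ (C : K →L[ℂ] K), star C = -C → ∀ (x : K) (t : ℝ),
      ‖NormedSpace.exp (t • C) x - x‖ ≤ ‖C x‖ * |t| := by
    intro C hC x t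
    have h := Convex.norm_image_sub_le_of_norm_hasDerivWithin_le (s := Set.univ) (x := (0 : ℝ))
      (y := t) (C := ‖C x‖) (fun s _ => (hder C x s).hasDerivWithinAt)
      (fun s _ => (hnorm _ (hskew C hC s) _).le) convex_univ (Set.mem_univ _) (Set.mem_univ _)
    simpa using h
  set V : ℕ → ℝ → K →L[ℂ] K := fun n t => NormedSpace.exp (t • B n) with hV
  have hVu : ∀ n t, V n t ∈ unitary (K →L[ℂ] K) := fun n t => hskew _ (hB n) t
  have hdiff : ∀ n m t x, ‖V n t x - V m t x‖ ≤ ‖B n x - B m x‖ * |t| := by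
    intro n m t x
    have h1 : V n t = V m t * NormedSpace.exp (t • (B n - B m)) := by
      rw [hV]
      simp only
      rw [← NormedSpace.exp_add_of_commute]
      · congr 1
        module
      · exact (((hc m n).sub_right (Commute.refl _)).smul_right t).smul_left t
    have h2 : V n t x - V m t x = V m t (NormedSpace.exp (t • (B n - B m)) x - x) := by
      rw [map_sub, h1]; rfl
    rw [h2, hnorm _ (hVu m t)]
    refine hest _ ?_ x t
    rw [star_sub, hB, hB]
    abel
  have hcauchy : ∀ (x : K) (T ε : ℝ), 0 < T → 0 < ε → ∃ N, ∀ n ≥ N, ∀ m ≥ N, ∀ t : ℝ, |t| ≤ T →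
      ‖V n t x - V m t x‖ ≤ ε := by
    intro x T ε hT hε
    obtain ⟨d, hd, hdx⟩ := hD.exists_dist_lt x (show (0 : ℝ) < ε / 4 by positivity)
    obtain ⟨N, hN⟩ := Metric.cauchySeq_iff.1 (hA d hd).cauchySeq (ε / (2 * T)) (by positivity)
    refine ⟨N, fun n hn m hm t ht => ?_⟩
    have h1 := (hdiff n m t d).trans (mul_le_mul (hN n hn m hm).le ht (abs_nonneg _)
      (by positivity) |>.trans' (by rw [dist_eq_norm]))
    have h2 : ε / (2 * T) * T = ε / 2 := by field_simp
    rw [h2] at h1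
    have h3 : ∀ k, ‖V k t x - V k t d‖ ≤ ε / 4 := fun k => by
      rw [← map_sub, hnorm _ (hVu k t), ← dist_eq_norm]; exact hdx.le
    have h4 : V n t x - V m t x
        = (V n t x - V n t d) + (V n t d - V m t d) - (V m t x - V m t d) := by abel
    rw [h4]
    refine (norm_sub_le _ _).trans ?_
    have h5 := norm_add_le (V n t x - V n t d) (V n t d - V m t d)
    have h6 := h3 n
    have h7 := h3 m
    linarith
  have hlim : ∀ t x, ∃ y, Filter.Tendsto (fun n => V n t x) Filter.atTop (nhds y) := by
    intro t x
    refine cauchySeq_tendsto_of_complete (Metric.cauchySeq_iff.2 fun ε hε => ?_)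
    obtain ⟨N, hN⟩ := hcauchy x (|t| + 1) (ε / 2) (by positivity) (by positivity)
    refine ⟨N, fun n hn m hm => ?_⟩
    rw [dist_eq_norm]
    exact (hN n hn m hm t (by linarith)).trans_lt (by linarith)
  choose u hu using hlim
  have hunorm : ∀ t x, ‖u t x‖ = ‖x‖ := fun t x =>
    tendsto_nhds_unique ((hu t x).norm.congr fun n => hnorm _ (hVu n t) x) tendsto_const_nhds |>.symm
      ▸ rfl
  let U : ℝ → K →L[ℂ] K := fun t => LinearMap.mkContinuous
    { toFun := u t
      map_add' := fun x y => tendsto_nhds_unique (hu t (x + y))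
        (((hu t x).add (hu t y)).congr fun n => (map_add _ _ _).symm)
      map_smul' := fun c x => tendsto_nhds_unique (hu t (c • x))
        (((hu t x).const_smul c).congr fun n => (map_smul _ _ _).symm) } 1
    fun x => by simpa using (hunorm t x).le
  have hUu : ∀ t x, U t x = u t x := fun t x => rfl
  have hunif : ∀ (x : K) (T ε : ℝ), 0 < T → 0 < ε → ∃ N, ∀ n ≥ N, ∀ t : ℝ, |t| ≤ T →
      ‖V n t x - U t x‖ ≤ ε := by
    intro x T ε hT hε
    obtain ⟨N, hN⟩ := hcauchy x T ε hT hε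
    refine ⟨N, fun n hn t ht => ?_⟩
    refine le_of_tendsto ((tendsto_const_nhds (x := V n t x)).sub (hu t x)).norm ?_
    filter_upwards [Filter.eventually_ge_atTop N] with m hm using hN n hn m hm t ht
  have hzero : U 0 = 1 := by
    ext x
    refine tendsto_nhds_unique (hu 0 x) ?_
    simp [hV]
  have hadd : ∀ s t, U (s + t) = U s * U t := by
    intro s t
    ext x
    refine tendsto_nhds_unique (hu (s + t) x) ?_
    have h1 : Filter.Tendsto (fun n => V n s (V n t x) - V n s (U t x)) Filter.atTop (nhds 0) := by
      rw [tendsto_zero_iff_norm_tendsto_zero]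
      have h2 := ((hu t x).sub (tendsto_const_nhds (x := U t x))).norm
      rw [hUu, sub_self, norm_zero] at h2
      refine h2.congr fun n => ?_
      rw [← map_sub, hnorm _ (hVu n s), hUu]
    have h3 := h1.add (hu s (U t x))
    rw [zero_add] at h3
    refine h3.congr fun n => ?_
    rw [sub_add_cancel]
    have h4 : V n (s + t) = V n s * V n t := by
      rw [hV]
      simp only
      rw [add_smul, NormedSpace.exp_add_of_commute]
      exact ((Commute.refl _).smul_right t).smul_left s
    rw [h4]; rfl
  have hunit : ∀ t, U t ∈ unitary (K →L[ℂ] K) := by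
    intro t
    have h1 : star (U t) * U t = 1 :=
      (ContinuousLinearMap.norm_map_iff_adjoint_comp_self (U t)).1 fun x => hunorm t x
    have h2 : U t * U (-t) = 1 := by rw [← hadd]; simp [hzero]
    have h3 : star (U t) = U (-t) := by
      calc star (U t) = star (U t) * (U t * U (-t)) := by rw [h2, mul_one]
        _ = U (-t) := by rw [← mul_assoc, h1, one_mul]
    exact Unitary.mem_iff.2 ⟨h1, by rw [h3, h2]⟩
  refine ⟨U, hzero, hadd, hunit, fun x => ?_, fun x hx => ?_⟩
  · have h1 : TendstoLocallyUniformly (fun n t => V n t x) (fun t => U t x) Filter.atTop := by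
      rw [Metric.tendstoLocallyUniformly_iff]
      intro ε hε t
      obtain ⟨N, hN⟩ := hunif x (|t| + 1) (ε / 2) (by positivity) (by positivity)
      refine ⟨Metric.ball t 1, Metric.ball_mem_nhds t one_pos, ?_⟩
      filter_upwards [Filter.eventually_ge_atTop N] with n hn s hs
      rw [dist_comm, dist_eq_norm]
      refine (hN n hn s ?_).trans_lt (by linarith)
      have h2 := abs_sub_abs_le_abs_sub s t
      rw [Metric.mem_ball, Real.dist_eq] at hs
      linarith
    refine h1.continuous (Filter.Frequently.of_forall fun n => ?_)
    exact continuous_iff_continuousAt.2 fun t => (hder (B n) x t).continuousAt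
  · have h1 : TendstoUniformlyOn (fun n t => V n t (B n x)) (fun t => U t (A x)) Filter.atTop
        (Metric.ball (0 : ℝ) 1) := by
      rw [Metric.tendstoUniformlyOn_iff]
      intro ε hε
      obtain ⟨N, hN⟩ := hunif (A x) 1 (ε / 4) one_pos (by positivity)
      obtain ⟨N', hN'⟩ := Metric.tendsto_atTop.1 (hA x hx) (ε / 4) (by positivity)
      filter_upwards [Filter.eventually_ge_atTop (max N N')] with n hn t ht
      rw [Metric.mem_ball, Real.dist_eq, sub_zero] at ht
      have h2 := hN n (le_of_max_le_left hn) t ht.le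
      have h3 := hN' n (le_of_max_le_right hn)
      have h4 : ‖V n t (B n x) - V n t (A x)‖ < ε / 4 := by
        rw [← map_sub, hnorm _ (hVu n t), ← dist_eq_norm]; exact h3
      rw [dist_comm, dist_eq_norm]
      have h5 := norm_add_le (V n t (B n x) - V n t (A x)) (V n t (A x) - U t (A x))
      rw [sub_add_sub_cancel] at h5
      linarith
    have h2 := hasDerivAt_of_tendstoUniformlyOn (x := (0 : ℝ)) Metric.isOpen_ball h1
      (Filter.Eventually.of_forall fun n t _ => hder (B n) x t) (fun t _ => hu t x)
      (Metric.mem_ball_self one_pos)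
    rw [hzero] at h2
    exact h2

theorem exists_isSchrodingerGroup [CompleteSpace K] {ħ : ℝ} (hħ : ħ ≠ 0) {H : K →ₗ.[ℂ] K}
    (hH : IsSelfAdjoint H) : ∃ U, IsSchrodingerGroup ħ H U := by
  obtain ⟨B, hB1, hB2, hB3⟩ := exists_approximants hH
  have hc0 : (ħ : ℂ) ≠ 0 := Complex.ofReal_ne_zero.2 hħ
  classical
  obtain ⟨U, h0, hadd, hunit, hcont, hder⟩ := exists_group_of_approximants
    (H.domain : Set K) hH.dense_domain
    (fun x => if h : x ∈ H.domain then -(Complex.I / (ħ : ℂ)) • H ⟨x, h⟩ else 0)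
    (fun n => -(Complex.I / (ħ : ℂ)) • B n) (fun n => by
      rw [star_smul, hB1, ← neg_smul]
      congr 1
      simp [neg_div])
    (fun n m => ((hB2 n m).smul_right _).smul_left _) (fun x hx => by
      have hx' : x ∈ H.domain := hx
      simp only [hx', dif_pos]
      exact (hB3 ⟨x, hx'⟩).const_smul _)
  have hder' : ∀ x : H.domain,
      HasDerivAt (fun t => U t (x : K)) (-(Complex.I / (ħ : ℂ)) • H x) 0 := fun x => by
    simpa using hder x x.2
  refine ⟨U, h0, hadd, hunit, hcont, fun x => ⟨fun hx => (hder' ⟨x, hx⟩).differentiableAt,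
    fun hx => ?_⟩, hder'⟩
  have hstar : ∀ t, star (U t) = U (-t) := by
    intro t
    have h2 : U t * U (-t) = 1 := by rw [← hadd]; simp [h0]
    calc star (U t) = star (U t) * (U t * U (-t)) := by rw [h2, mul_one]
      _ = U (-t) := by rw [← mul_assoc, (Unitary.mem_iff.1 (hunit t)).1, one_mul]
  have hx' := hx.hasDerivAt
  generalize deriv (fun t => U t x) 0 = x' at hx'
  refine (selfAdjoint_mem hH x ((Complex.I * (ħ : ℂ)) • x') fun w => ?_).1
  have h1 : HasDerivAt (fun t => ⟪U t x, (w : K)⟫_ℂ) ⟪x', (w : K)⟫_ℂ 0 := by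
    simpa using hx'.inner ℂ (hasDerivAt_const (0 : ℝ) (w : K))
  have hw : HasDerivAt (fun t : ℝ => U (-t) (w : K)) (-(-(Complex.I / (ħ : ℂ)) • H w)) 0 := by
    have h := HasDerivAt.scomp (0 : ℝ) (h := fun t : ℝ => -t)
      (by simpa using hder' w) (hasDerivAt_neg (0 : ℝ))
    simpa [Function.comp_def] using h
  have h2 : HasDerivAt (fun t => ⟪x, U (-t) (w : K)⟫_ℂ) ⟪x, (Complex.I / (ħ : ℂ)) • H w⟫_ℂ 0 := by
    simpa [inner_smul_right] using (hasDerivAt_const (0 : ℝ) x).inner ℂ hw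
  have h3 : (fun t => ⟪U t x, (w : K)⟫_ℂ) = fun t => ⟪x, U (-t) (w : K)⟫_ℂ := by
    funext t
    rw [← hstar, ContinuousLinearMap.star_eq_adjoint, ContinuousLinearMap.adjoint_inner_right]
  rw [h3] at h1
  have h4 := h1.unique h2
  rw [inner_smul_left, h4, inner_smul_right, map_mul, Complex.conj_I, Complex.conj_ofReal]
  have h5 : -Complex.I * (ħ : ℂ) * (Complex.I / (ħ : ℂ)) = 1 := by
    field_simp
    simp
  rw [← mul_assoc, h5, one_mul]

/-- The group `U(t) = exp(-i t H / ħ)` of a self-adjoint operator `H`. -/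
def schrodingerGroup [CompleteSpace K] (ħ : ℝ) (H : K →ₗ.[ℂ] K) : ℝ → K →L[ℂ] K :=
  open Classical in if h : ∃ U, IsSchrodingerGroup ħ H U then h.choose else fun _ => 1

theorem isSchrodingerGroup_schrodingerGroup [CompleteSpace K] {ħ : ℝ} (hħ : ħ ≠ 0)
    {H : K →ₗ.[ℂ] K} (hH : IsSelfAdjoint H) :
    IsSchrodingerGroup ħ H (schrodingerGroup ħ H) := by
  have h := exists_isSchrodingerGroup hħ hH
  rw [schrodingerGroup, dif_pos h]
  exact h.choose_spec

end Operators

/-! ### Trajectories of the observed scattering process -/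

section Trajectories

variable {Λ : Type*}

/-- A trajectory `υ = ((t₁, y₁), (t₂, y₂), …)`: strictly increasing scattering times, finitely many
of them before any given time, and the registered pointer positions. Numbering starts at `0`. -/
structure Trajectory (Λ : Type*) where
  time : ℕ → ℝ
  mark : ℕ → Λ
  time_nonneg : ∀ n, 0 ≤ time n
  time_strictMono : StrictMono time
  finite_before : ∀ t : ℝ, {r | r ∈ Set.range time ∧ r < t}.Finite

/-- The set `τ_t = τ ∩ [0, t)` of scattering times before `t`. -/
def Trajectory.timesBefore (υ : Trajectory Λ) (t : ℝ) : Finset ℝ :=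
  (υ.finite_before t).toFinset

/-- The number `n_t = |τ_t|` of scatterings before `t`. -/
def Trajectory.count (υ : Trajectory Λ) (t : ℝ) : ℕ :=
  (υ.timesBefore t).card

open Classical in
/-- The partitions `τ = σ₁ ⊔ ⋯ ⊔ σ_M` of a finite set of times into `M` labelled (possibly empty)
disjoint parts; `σ k` is the set of scattering times of the `k`-th particle. -/
def partitions (M : ℕ) (τ : Finset ℝ) : Finset (Fin M → Finset ℝ) :=
  (Fintype.piFinset fun _ => τ.powerset).filter fun σ =>
    (∀ k l, k ≠ l → Disjoint (σ k) (σ l)) ∧ Finset.univ.biUnion σ = τ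

end Trajectories

/-! ### The mixing reduction dynamics of `M` particles -/

section Dynamics

variable {Λ E : Type*} [NormedAddCommGroup E] [InnerProductSpace ℂ E] {M : ℕ}

/-- `G_t(k, r, y) = U(r)† G(k, y) U(r)`, where `G(k, y)` is `G(y)` acting on the `k`-th particle. -/
def heisenbergReduction (U : ℝ → TensorPower M E →L[ℂ] TensorPower M E) (G : Λ → E →L[ℂ] E)
    (k : Fin M) (r : ℝ) (y : Λ) : TensorPower M E →L[ℂ] TensorPower M E :=
  star (U r) * slot k (G y) * U r

/-- `G_t(kₙ, tₙ, yₙ)`, where `kₙ` is the particle scattered at the time `tₙ` according to the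
partition `σ` (the only `k` with `tₙ ∈ σ k`). -/
def scatteringFactor (U : ℝ → TensorPower M E →L[ℂ] TensorPower M E) (G : Λ → E →L[ℂ] E)
    (υ : Trajectory Λ) (σ : Fin M → Finset ℝ) (n : ℕ) : TensorPower M E →L[ℂ] TensorPower M E :=
  ∑ k with υ.time n ∈ σ k, heisenbergReduction U G k (υ.time n) (υ.mark n)

/-- `F_t(σ, y) = G_t(k₁, t₁, y₁)† G_t(k₂, t₂, y₂)† ⋯`, over all scatterings before `t`. -/
def chronologicalProduct (U : ℝ → TensorPower M E →L[ℂ] TensorPower M E) (G : Λ → E →L[ℂ] E)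
    (υ : Trajectory Λ) (t : ℝ) (σ : Fin M → Finset ℝ) : TensorPower M E →L[ℂ] TensorPower M E :=
  ((List.range (υ.count t)).map fun n => star (scatteringFactor U G υ σ n)).prod

/-- `Φ_t[X](υ) = M^{-n_t} ∑_{⊔ σ_k = τ_t} F_t(σ, y) X F_t(σ, y)†`. -/
def reduction (U : ℝ → TensorPower M E →L[ℂ] TensorPower M E) (G : Λ → E →L[ℂ] E)
    (υ : Trajectory Λ) (t : ℝ) (X : TensorPower M E →L[ℂ] TensorPower M E) :
    TensorPower M E →L[ℂ] TensorPower M E :=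
  ((M : ℂ) ^ υ.count t)⁻¹ • ∑ σ ∈ partitions M (υ.timesBefore t),
    chronologicalProduct U G υ t σ * X * star (chronologicalProduct U G υ t σ)

/-- `Θ[X](t, υ) = Φ_t[U(t)† X U(t)](υ)`. -/
def reducedDynamics (U : ℝ → TensorPower M E →L[ℂ] TensorPower M E) (G : Λ → E →L[ℂ] E)
    (υ : Trajectory Λ) (t : ℝ) (X : TensorPower M E →L[ℂ] TensorPower M E) :
    TensorPower M E →L[ℂ] TensorPower M E :=
  reduction U G υ t (star (U t) * X * U t)

/-- The stochastic propagator `T(t, σ, y) = U(t) F_t(σ, y)†`. -/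
def propagator (U : ℝ → TensorPower M E →L[ℂ] TensorPower M E) (G : Λ → E →L[ℂ] E)
    (υ : Trajectory Λ) (t : ℝ) (σ : Fin M → Finset ℝ) : TensorPower M E →L[ℂ] TensorPower M E :=
  U t * star (chronologicalProduct U G υ t σ)

/-- The a posteriori density operator
`ρ(t, υ) = M^{-n_t} ∑_{⊔ σ_k = τ_t} T(t, σ, y) ρ₀ T(t, σ, y)†`. -/
def posteriorDensity (U : ℝ → TensorPower M E →L[ℂ] TensorPower M E) (G : Λ → E →L[ℂ] E)
    (ρ₀ : TensorPower M E →L[ℂ] TensorPower M E) (υ : Trajectory Λ) (t : ℝ) :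
    TensorPower M E →L[ℂ] TensorPower M E :=
  ((M : ℂ) ^ υ.count t)⁻¹ • ∑ σ ∈ partitions M (υ.timesBefore t),
    propagator U G υ t σ * ρ₀ * star (propagator U G υ t σ)

/-- The single mixing reduction `Ψ[X](r, y) = M⁻¹ ∑ₖ G_t(k, r, y)† X G_t(k, r, y)`. -/
def mixingReduction (U : ℝ → TensorPower M E →L[ℂ] TensorPower M E) (G : Λ → E →L[ℂ] E)
    (r : ℝ) (y : Λ) (X : TensorPower M E →L[ℂ] TensorPower M E) :
    TensorPower M E →L[ℂ] TensorPower M E :=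
  (M : ℂ)⁻¹ • ∑ k, star (heisenbergReduction U G k r y) * X * heisenbergReduction U G k r y

/-- The chronological composition `Ψ(t₁, y₁) ∘ Ψ(t₂, y₂) ∘ ⋯ ∘ Ψ(tₙ, yₙ)`, with `n = n_t`. -/
def mixingComposition (U : ℝ → TensorPower M E →L[ℂ] TensorPower M E) (G : Λ → E →L[ℂ] E)
    (υ : Trajectory Λ) (t : ℝ) (X : TensorPower M E →L[ℂ] TensorPower M E) :
    TensorPower M E →L[ℂ] TensorPower M E :=
  (List.range (υ.count t)).foldr (fun n Z => mixingReduction U G (υ.time n) (υ.mark n) Z) X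

/-- The jump `M⁻¹ ∑ₖ G(k, y) ρ G(k, y)† - ρ` of the density operator at a scattering. -/
def densityJump (G : Λ → E →L[ℂ] E) (y : Λ) (ρ : TensorPower M E →L[ℂ] TensorPower M E) :
    TensorPower M E →L[ℂ] TensorPower M E :=
  (M : ℂ)⁻¹ • (∑ k, slot k (G y) * ρ * star (slot k (G y))) - ρ

/-- `ρ(t)`, `t ≥ 0`, is a solution along the trajectory `υ` of the forward (Itô) differential
equation
`dρ + (i/ħ) [H, ρ] dt = dn_t (M⁻¹ ∑ₖ G(k) ρ G(k)† - ρ)`, `ρ(0) = ρ₀`.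
As `H` may be unbounded, the equation is read on matrix elements between vectors of its domain;
the integral of the right-hand side over `[0, t)` is the sum over the scatterings before `t`. -/
structure IsSolution (ħ : ℝ) (H : TensorPower M E →ₗ.[ℂ] TensorPower M E) (G : Λ → E →L[ℂ] E)
    (ρ₀ : TensorPower M E →L[ℂ] TensorPower M E) (υ : Trajectory Λ)
    (ρ : ℝ → TensorPower M E →L[ℂ] TensorPower M E) : Prop where
  initial : ρ 0 = ρ₀
  integrable : ∀ (φ ψ : H.domain) (t : ℝ), 0 ≤ t → IntervalIntegrable
    (fun s => ⟪H φ, ρ s (ψ : TensorPower M E)⟫_ℂ - ⟪(φ : TensorPower M E), ρ s (H ψ)⟫_ℂ)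
    MeasureTheory.volume 0 t
  equation : ∀ (φ ψ : H.domain) (t : ℝ), 0 ≤ t →
    ⟪(φ : TensorPower M E), ρ t (ψ : TensorPower M E)⟫_ℂ
        - ⟪(φ : TensorPower M E), ρ₀ (ψ : TensorPower M E)⟫_ℂ
      + Complex.I / (ħ : ℂ) * (∫ s in (0 : ℝ)..t,
          (⟪H φ, ρ s (ψ : TensorPower M E)⟫_ℂ - ⟪(φ : TensorPower M E), ρ s (H ψ)⟫_ℂ))
      = ∑ n ∈ Finset.range (υ.count t),
          ⟪(φ : TensorPower M E), densityJump G (υ.mark n) (ρ (υ.time n)) (ψ : TensorPower M E)⟫_ℂ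

/-- The integral form of the same equation:
`ρ(t) = U(t) ρ₀ U(t)† + ∑_{tₙ < t} U(t - tₙ) (M⁻¹ ∑ₖ G(k) ρ(tₙ) G(k)† - ρ(tₙ)) U(t - tₙ)†`. -/
def IsIntegralSolution (U : ℝ → TensorPower M E →L[ℂ] TensorPower M E) (G : Λ → E →L[ℂ] E)
    (ρ₀ : TensorPower M E →L[ℂ] TensorPower M E) (υ : Trajectory Λ)
    (ρ : ℝ → TensorPower M E →L[ℂ] TensorPower M E) : Prop :=
  ∀ t : ℝ, 0 ≤ t → ρ t = U t * ρ₀ * star (U t) + ∑ n ∈ Finset.range (υ.count t),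
    U (t - υ.time n) * densityJump G (υ.mark n) (ρ (υ.time n)) * star (U (t - υ.time n))

end Dynamics

end MixingReduction

end

/-!
In the interaction picture the a posteriori density operator `U(t)† ρ(t) U(t)` changes only at the
scatterings. Partitions of the first `N` scattering times are the same as labellings
`Fin N → Fin M` of the scatterings by particles (`sum_partitions`), and a labelling of `N + 1`
scatterings is a labelling of `N` of them and the label of the last one. So the averages over
partitions obey one-step recursions (`averageConj_succ`, `averageConjStar_succ`). For the reduction
the recursion is the composition law; for the density operator it turns the sum of the transported
jumps in the integral equation into a telescoping sum (`isIntegralSolution_posteriorDensity`).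

The square root of a positive operator with a trace is a Hilbert–Schmidt operator, and for
Hilbert–Schmidt operators `Tr (P† Q) = Tr (Q P†)` in any two orthonormal bases, by exchanging a
double sum of matrix elements (`exists_hasSum_swap`). The resulting cyclicity of the trace
(`exists_hasTrace_cyclic`) gives `Tr (X ρ(t)) = Tr (Θ_t[X] ρ₀)` term by term, and with `X = 1` that
`ρ(t)` has a trace.

An integral solution solves the differential equation because each `U(t - tₙ) A U(t - tₙ)†`
satisfies the von Neumann equation on domain vectors (`IsIntegralSolution.isSolution`). Conversely,
by induction on the number of scatterings, the difference `δ` of two solutions satisfies the von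
Neumann equation without jumps and with initial value zero. A priori `δ(s)` need not be bounded
uniformly in `s`, nor are its matrix elements differentiable. Both are repaired by the resolvent
`R = (H + i)⁻¹`: the operators `R† δ(s) R` are weakly continuous, hence bounded on compact intervals
by the Banach–Steinhaus theorem, and have differentiable matrix elements between domain vectors, so
that `⟪U(s) φ, R† δ(s) R U(s) ψ⟫` is constant and therefore zero (`eq_zero_of_vonNeumann`).
Hence solutions are unique, and the two forms of the equation are equivalent.
-/

noncomputable section

namespace MixingReduction

/-! ### Hilbert–Schmidt operators and the trace -/

section Trace

variable {K : Type*} [NormedAddCommGroup K] [InnerProductSpace ℂ K]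

/-- Parseval's identity for the squared norm. -/
theorem hasSum_norm_inner_sq {ι : Type*} (e : HilbertBasis ι ℂ K) (v : K) :
    HasSum (fun j => ‖⟪e j, v⟫_ℂ‖ ^ 2) (‖v‖ ^ 2) := by
  have h := e.hasSum_inner_mul_inner v v
  rw [inner_self_eq_ofReal] at h
  rw [← Complex.hasSum_ofReal]
  refine h.congr_fun fun j => ?_
  rw [← inner_conj_symm v (e j), ← Complex.normSq_eq_conj_mul_self, Complex.normSq_eq_norm_sq]

theorem summable_matrix_sq {ι κ : Type*} (b : HilbertBasis ι ℂ K) (e : HilbertBasis κ ℂ K)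
    {P : K →L[ℂ] K} (hP : Summable fun i => ‖P (b i)‖ ^ 2) :
    Summable fun p : ι × κ => ‖⟪e p.2, P (b p.1)⟫_ℂ‖ ^ 2 := by
  rw [summable_prod_of_nonneg fun p => sq_nonneg _]
  refine ⟨fun i => (hasSum_norm_inner_sq e (P (b i))).summable, hP.congr fun i => ?_⟩
  exact (hasSum_norm_inner_sq e (P (b i))).tsum_eq.symm

theorem HasTrace.smul {A : K →L[ℂ] K} {a : ℂ} (h : HasTrace A a) (z : ℂ) :
    HasTrace (z • A) (z * a) := fun S b => by
  simpa [inner_smul_right] using (h S b).mul_left z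

theorem HasTrace.sum {ι : Type*} {s : Finset ι} {A : ι → K →L[ℂ] K} {a : ι → ℂ}
    (h : ∀ i ∈ s, HasTrace (A i) (a i)) : HasTrace (∑ i ∈ s, A i) (∑ i ∈ s, a i) := fun S b => by
  simpa [inner_sum, _root_.sum_apply] using hasSum_sum fun i hi => h i hi S b

/-- A Hilbert–Schmidt operator: `∑ᵢ ‖P bᵢ‖²` converges in every orthonormal basis. -/
def IsHilbertSchmidt (P : K →L[ℂ] K) : Prop :=
  ∀ (S : Set K) (b : HilbertBasis S ℂ K), Summable fun i => ‖P (b i)‖ ^ 2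

theorem IsHilbertSchmidt.mul_left {P : K →L[ℂ] K} (hP : IsHilbertSchmidt P) (A : K →L[ℂ] K) :
    IsHilbertSchmidt (A * P) := by
  intro S b
  refine Summable.of_nonneg_of_le (fun i => sq_nonneg _) (fun i => ?_)
    ((hP S b).mul_left (‖A‖ ^ 2))
  rw [← mul_pow]
  exact pow_le_pow_left₀ (norm_nonneg _) (A.le_opNorm _) 2

variable [CompleteSpace K]

theorem inner_star_left (A : K →L[ℂ] K) (x y : K) : ⟪star A x, y⟫_ℂ = ⟪x, A y⟫_ℂ :=
  ContinuousLinearMap.adjoint_inner_left A y x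

theorem inner_star_right (A : K →L[ℂ] K) (x y : K) : ⟪x, star A y⟫_ℂ = ⟪A x, y⟫_ℂ :=
  ContinuousLinearMap.adjoint_inner_right A x y

/-- If `∑ᵢ ‖P bᵢ‖²` converges in one orthonormal basis, then so does `∑ⱼ ‖P† eⱼ‖²` in any other: both
are the sum of the squared moduli of all the matrix elements. -/
theorem summable_adjoint_sq {ι κ : Type*} (b : HilbertBasis ι ℂ K) (e : HilbertBasis κ ℂ K)
    {P : K →L[ℂ] K} (hP : Summable fun i => ‖P (b i)‖ ^ 2) :
    Summable fun j => ‖(star P) (e j)‖ ^ 2 := by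
  have h := (summable_matrix_sq b e hP).prod_symm
  rw [summable_prod_of_nonneg fun p => sq_nonneg _] at h
  refine h.2.congr fun j => ?_
  rw [← (hasSum_norm_inner_sq b (star P (e j))).tsum_eq]
  refine tsum_congr fun i => ?_
  rw [inner_star_right, norm_inner_symm]
  rfl

theorem IsHilbertSchmidt.star {P : K →L[ℂ] K} (hP : IsHilbertSchmidt P) :
    IsHilbertSchmidt (star P) :=
  fun S b => summable_adjoint_sq b b (hP S b)

theorem IsHilbertSchmidt.mul_right {P : K →L[ℂ] K} (hP : IsHilbertSchmidt P) (A : K →L[ℂ] K) :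
    IsHilbertSchmidt (P * A) := by
  have h := (hP.star.mul_left (Star.star A)).star
  rwa [star_mul, star_star, star_star] at h

/-- For Hilbert–Schmidt `P`, `Q` the trace of `P† Q` in one basis is the trace of `Q P†` in any
other: both are the double sum of the products of matrix elements. -/
theorem exists_hasSum_swap {S S' : Set K} (b : HilbertBasis S ℂ K) (e : HilbertBasis S' ℂ K)
    {P Q : K →L[ℂ] K} (hP : IsHilbertSchmidt P) (hQ : IsHilbertSchmidt Q) :
    ∃ c, HasSum (fun i => ⟪b i, (star P * Q) (b i)⟫_ℂ) c ∧
      HasSum (fun j => ⟪e j, (Q * star P) (e j)⟫_ℂ) c := by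
  let f : S × S' → ℂ := fun p => ⟪P (b p.1), e p.2⟫_ℂ * ⟪e p.2, Q (b p.1)⟫_ℂ
  have hs : Summable f := by
    refine Summable.of_norm_bounded
      ((summable_matrix_sq b e (hP S b)).add (summable_matrix_sq b e (hQ S b))) fun p => ?_
    -- `|z w| ≤ |z|² + |w|²`
    rw [norm_mul, norm_inner_symm]
    nlinarith [sq_nonneg (‖⟪e p.2, P (b p.1)⟫_ℂ‖ - ‖⟪e p.2, Q (b p.1)⟫_ℂ‖),
      sq_nonneg (‖⟪e p.2, P (b p.1)⟫_ℂ‖), sq_nonneg ‖⟪e p.2, Q (b p.1)⟫_ℂ‖]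
  have h1 : ∀ i, HasSum (fun j => f (i, j)) ⟪b i, (star P * Q) (b i)⟫_ℂ := by
    intro i
    rw [mul_apply_eq_comp, inner_star_right]
    exact e.hasSum_inner_mul_inner (P (b i)) (Q (b i))
  have h2 : ∀ j, HasSum (fun i => f (i, j)) ⟪e j, (Q * star P) (e j)⟫_ℂ := by
    intro j
    rw [mul_apply_eq_comp, ← inner_star_left]
    refine (b.hasSum_inner_mul_inner (star Q (e j)) (star P (e j))).congr_fun fun i => ?_
    rw [inner_star_left, inner_star_right, mul_comm]
  exact ⟨∑' p, f p, hs.hasSum.prod_fiberwise h1,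
    ((Equiv.prodComm S' S).hasSum_iff.2 hs.hasSum).prod_fiberwise h2⟩

/-- Cyclicity `Tr (P† Q) = Tr (Q P†)` for Hilbert–Schmidt operators. -/
theorem exists_hasTrace_swap {P Q : K →L[ℂ] K} (hP : IsHilbertSchmidt P)
    (hQ : IsHilbertSchmidt Q) : ∃ c, HasTrace (star P * Q) c ∧ HasTrace (Q * star P) c := by
  obtain ⟨S₀, b₀, -⟩ := exists_hilbertBasis ℂ K
  obtain ⟨c, h1, h2⟩ := exists_hasSum_swap b₀ b₀ hP hQ
  refine ⟨c, fun S b => ?_, fun S b => ?_⟩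
  · obtain ⟨c', h3, h4⟩ := exists_hasSum_swap b b₀ hP hQ
    rwa [h2.unique h4]
  · obtain ⟨c', h3, h4⟩ := exists_hasSum_swap b₀ b hP hQ
    rwa [h1.unique h3]

/-- A positive operator with a trace is the square of a self-adjoint Hilbert–Schmidt operator. -/
theorem exists_hilbertSchmidt_sqrt {A : K →L[ℂ] K} (hA : A.IsPositive) {c : ℂ}
    (hc : HasTrace A c) : ∃ R : K →L[ℂ] K, star R = R ∧ R * R = A ∧ IsHilbertSchmidt R := by
  have h0 : 0 ≤ A := (ContinuousLinearMap.nonneg_iff_isPositive A).2 hA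
  have hR : star (CFC.sqrt A) = CFC.sqrt A := (CFC.sqrt_nonneg A).isSelfAdjoint
  have hRR : CFC.sqrt A * CFC.sqrt A = A := CFC.sqrt_mul_sqrt_self A
  refine ⟨CFC.sqrt A, hR, hRR, fun S b => ?_⟩
  have h := (hc S b).summable
  rw [← Complex.summable_ofReal]
  refine h.congr fun i => ?_
  nth_rewrite 1 [← hRR, ← hR]
  rw [mul_apply_eq_comp, inner_star_right, inner_self_eq_ofReal]

/-- Cyclicity `Tr (B A C) = Tr (C B A)` for bounded `B`, `C` and a positive trace class `A`. -/
theorem exists_hasTrace_cyclic {A : K →L[ℂ] K} (hA : A.IsPositive) {a : ℂ} (ha : HasTrace A a)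
    (B C : K →L[ℂ] K) : ∃ c, HasTrace (B * A * C) c ∧ HasTrace (C * B * A) c := by
  obtain ⟨R, hR, hRR, hHS⟩ := exists_hilbertSchmidt_sqrt hA ha
  obtain ⟨c, h1, h2⟩ := exists_hasTrace_swap (hHS.mul_right (star B)) (hHS.mul_right C)
  obtain ⟨c', h3, h4⟩ := exists_hasTrace_swap hHS (hHS.mul_left (C * B))
  have e1 : star (R * star B) * (R * C) = B * A * C := by
    rw [star_mul, star_star, hR, ← hRR]; simp only [mul_assoc]
  have e2 : R * C * star (R * star B) = star R * (C * B * R) := by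
    rw [star_mul, star_star, hR]; simp only [mul_assoc]
  have e3 : C * B * R * star R = C * B * A := by
    rw [hR, ← hRR]; simp only [mul_assoc]
  rw [e1] at h1
  rw [e2] at h2
  rw [e3] at h4
  -- both traces of `R (C B R)` are the same number, as some orthonormal basis exists
  obtain ⟨S₀, b₀, -⟩ := exists_hilbertBasis ℂ K
  obtain rfl := (h2 S₀ b₀).unique (h3 S₀ b₀)
  exact ⟨c, h1, h4⟩

end Trace

/-! ### Schrödinger groups -/

section Group

variable {K : Type*} [NormedAddCommGroup K] [InnerProductSpace ℂ K] [CompleteSpace K]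
  {ħ : ℝ} {H : K →ₗ.[ℂ] K} {U : ℝ → K →L[ℂ] K}

theorem IsSchrodingerGroup.star_eq (hU : IsSchrodingerGroup ħ H U) (t : ℝ) :
    star (U t) = U (-t) := by
  have h2 : U t * U (-t) = 1 := by rw [← hU.add]; simp [hU.zero]
  calc star (U t) = star (U t) * (U t * U (-t)) := by rw [h2, mul_one]
    _ = U (-t) := by rw [← mul_assoc, (Unitary.mem_iff.1 (hU.unitary t)).1, one_mul]

theorem IsSchrodingerGroup.apply_add (hU : IsSchrodingerGroup ħ H U) (s t : ℝ) (x : K) :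
    U (s + t) x = U s (U t x) := by
  rw [hU.add]; rfl

theorem IsSchrodingerGroup.apply_neg_apply (hU : IsSchrodingerGroup ħ H U) (t : ℝ) (x : K) :
    U t (U (-t) x) = x := by
  rw [← hU.apply_add, add_neg_cancel, hU.zero]; rfl

theorem IsSchrodingerGroup.hasDerivAt_apply (hU : IsSchrodingerGroup ħ H U) (x : H.domain)
    (t : ℝ) : HasDerivAt (fun s => U s (x : K)) (U t (-(Complex.I / (ħ : ℂ)) • H x)) t := by
  have h1 : HasDerivAt (fun s => U (s - t) (x : K)) (-(Complex.I / (ħ : ℂ)) • H x) t := by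
    have h := hU.hasDerivAt x
    rw [← sub_self t] at h
    exact h.comp_sub_const t t
  have h2 := (((U t).restrictScalars ℝ).hasFDerivAt).comp_hasDerivAt t h1
  refine h2.congr_of_eventuallyEq (Filter.Eventually.of_forall fun s => ?_)
  change U s (x : K) = U t (U (s - t) (x : K))
  rw [← hU.apply_add, add_sub_cancel]

/-- The group leaves the domain of its generator invariant and commutes with it. -/
theorem IsSchrodingerGroup.exists_apply_mem (hħ : ħ ≠ 0) (hU : IsSchrodingerGroup ħ H U)
    (x : H.domain) (t : ℝ) : ∃ h : U t (x : K) ∈ H.domain, H ⟨U t (x : K), h⟩ = U t (H x) := by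
  have h1 : HasDerivAt (fun s => U s (U t (x : K))) (U t (-(Complex.I / (ħ : ℂ)) • H x)) 0 := by
    have h2 := (((U t).restrictScalars ℝ).hasFDerivAt).comp_hasDerivAt (0 : ℝ) (hU.hasDerivAt x)
    refine h2.congr_of_eventuallyEq (Filter.Eventually.of_forall fun s => ?_)
    change U s (U t (x : K)) = U t (U s (x : K))
    rw [← hU.apply_add, ← hU.apply_add, add_comm]
  have hmem := (hU.mem_domain_iff _).2 h1.differentiableAt
  refine ⟨hmem, ?_⟩
  have h3 := (hU.hasDerivAt ⟨_, hmem⟩).unique h1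
  rw [map_smul] at h3
  have hc : -(Complex.I / (ħ : ℂ)) ≠ 0 :=
    neg_ne_zero.2 (div_ne_zero Complex.I_ne_zero (Complex.ofReal_ne_zero.2 hħ))
  exact smul_right_injective _ hc h3

theorem IsSchrodingerGroup.inner_conj (hU : IsSchrodingerGroup ħ H U) (A : K →L[ℂ] K) (x y : K)
    (t : ℝ) : ⟪x, (U t * A * star (U t)) y⟫_ℂ = ⟪U (-t) x, A (U (-t) y)⟫_ℂ := by
  have h : U t = star (U (-t)) := by rw [hU.star_eq, neg_neg]
  rw [mul_apply_eq_comp, mul_apply_eq_comp, hU.star_eq]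
  nth_rewrite 1 [h]
  rw [inner_star_right]

theorem IsSchrodingerGroup.continuous_inner_conj (hU : IsSchrodingerGroup ħ H U)
    (A : K →L[ℂ] K) (x y : K) :
    Continuous fun t => ⟪x, (U t * A * star (U t)) y⟫_ℂ := by
  simp only [hU.inner_conj]
  exact ((hU.continuous x).comp continuous_neg).inner
    (A.continuous.comp ((hU.continuous y).comp continuous_neg))

/-- The von Neumann equation for `U(t) A U(t)†`, on matrix elements between domain vectors. -/
theorem IsSchrodingerGroup.hasDerivAt_inner_conj (hU : IsSchrodingerGroup ħ H U)
    (A : K →L[ℂ] K) (φ ψ : H.domain) (t : ℝ) :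
    HasDerivAt (fun t => ⟪(φ : K), (U t * A * star (U t)) (ψ : K)⟫_ℂ)
      (-(Complex.I / (ħ : ℂ)) * (⟪H φ, (U t * A * star (U t)) (ψ : K)⟫_ℂ
        - ⟪(φ : K), (U t * A * star (U t)) (H ψ)⟫_ℂ)) t := by
  have hd : ∀ x : H.domain, HasDerivAt (fun s => U (-s) (x : K))
      (U (-t) ((Complex.I / (ħ : ℂ)) • H x)) t := fun x => by
    have h := (hU.hasDerivAt_apply x (-t)).scomp t (hasDerivAt_neg t)
    simpa [Function.comp_def] using h
  have h2 := ((A.restrictScalars ℝ).hasFDerivAt).comp_hasDerivAt t (hd ψ)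
  have h3 := (hd φ).inner ℂ h2
  simp only [hU.inner_conj]
  refine HasDerivAt.congr_deriv h3 ?_
  simp [inner_smul_left, inner_smul_right]
  ring

end Group

/-! ### Uniqueness for the von Neumann equation -/

section Uniqueness

variable {K : Type*} [NormedAddCommGroup K] [InnerProductSpace ℂ K]

theorem eq_zero_of_inner_eq_zero {D : Set K} (hD : Dense D) {A : K →L[ℂ] K}
    (h : ∀ x ∈ D, ∀ y ∈ D, ⟪x, A y⟫_ℂ = 0) : A = 0 := by
  have h1 : ∀ y ∈ D, A y = 0 := fun y hy =>
    hD.eq_zero_of_inner_right ℂ fun {x} hx => by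
      simpa using h x hx y hy
  exact ContinuousLinearMap.ext fun y =>
    congrFun (A.continuous.ext_on hD continuous_const h1) y

/-- Norm convergence of both vectors can be added to weak convergence of bounded operators. -/
theorem tendsto_inner_apply {α : Type*} {l : Filter α} {σ : α → K →L[ℂ] K} {C : ℝ}
    (hσ : ∀ᶠ r in l, ‖σ r‖ ≤ C) {u v : α → K} {u₀ v₀ : K} {c : ℂ}
    (hc : Filter.Tendsto (fun r => ⟪u₀, σ r v₀⟫_ℂ) l (nhds c))
    (hu : Filter.Tendsto u l (nhds u₀)) (hv : Filter.Tendsto v l (nhds v₀)) :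
    Filter.Tendsto (fun r => ⟪u r, σ r (v r)⟫_ℂ) l (nhds c) := by
  have h1 : Filter.Tendsto (fun r => ⟪u r - u₀, σ r (v r)⟫_ℂ) l (nhds 0) := by
    refine squeeze_zero_norm' (a := fun r => ‖u r - u₀‖ * (C * ‖v r‖)) ?_ ?_
    · filter_upwards [hσ] with r hr
      exact (norm_inner_le_norm _ _).trans (mul_le_mul_of_nonneg_left
        ((σ r).le_of_opNorm_le hr _) (norm_nonneg _))
    · have h := ((hu.sub_const u₀).norm).mul (hv.norm.const_mul C)
      simpa using h
  have h2 : Filter.Tendsto (fun r => ⟪u₀, σ r (v r - v₀)⟫_ℂ) l (nhds 0) := by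
    refine squeeze_zero_norm' (a := fun r => ‖u₀‖ * (C * ‖v r - v₀‖)) ?_ ?_
    · filter_upwards [hσ] with r hr
      exact (norm_inner_le_norm _ _).trans (mul_le_mul_of_nonneg_left
        ((σ r).le_of_opNorm_le hr _) (norm_nonneg _))
    · have h := (((hv.sub_const v₀).norm).const_mul C).const_mul ‖u₀‖
      simpa using h
  have h3 := (h1.add h2).add hc
  rw [add_zero, zero_add] at h3
  refine h3.congr fun r => ?_
  rw [inner_sub_left, map_sub, inner_sub_right]
  ring

/-- The product rule for `⟪x(r), σ(r) y(r)⟫` when the operators `σ(r)` are uniformly bounded but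
only weakly continuous, and only the one matrix element needed is differentiable. -/
theorem hasDerivWithinAt_inner_apply {σ : ℝ → K →L[ℂ] K} {C : ℝ} {s : Set ℝ} {t : ℝ}
    (hσ : ∀ r ∈ s, ‖σ r‖ ≤ C)
    (hcont : ∀ u v, ContinuousWithinAt (fun r => ⟪u, σ r v⟫_ℂ) s t)
    {x y : ℝ → K} {x' y' : K} {d : ℂ} (hx : HasDerivWithinAt x x' s t)
    (hy : HasDerivWithinAt y y' s t)
    (hd : HasDerivWithinAt (fun r => ⟪x t, σ r (y t)⟫_ℂ) d s t) :
    HasDerivWithinAt (fun r => ⟪x r, σ r (y r)⟫_ℂ)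
      (⟪x', σ t (y t)⟫_ℂ + ⟪x t, σ t y'⟫_ℂ + d) s t := by
  have hle : nhdsWithin t (s \ {t}) ≤ nhdsWithin t s := nhdsWithin_mono t Set.sdiff_subset
  have hσ' : ∀ᶠ r in nhdsWithin t (s \ {t}), ‖σ r‖ ≤ C :=
    hle (Filter.eventually_of_mem self_mem_nhdsWithin hσ)
  have hyc : Filter.Tendsto y (nhdsWithin t (s \ {t})) (nhds (y t)) :=
    hy.continuousWithinAt.mono_left hle
  rw [hasDerivWithinAt_iff_tendsto_slope] at hx hy hd ⊢
  have h1 := tendsto_inner_apply hσ' ((hcont x' (y t)).mono_left hle) hx hyc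
  have h2 := tendsto_inner_apply hσ' ((hcont (x t) y').mono_left hle)
    (tendsto_const_nhds (x := x t)) hy
  refine ((h1.add h2).add hd).congr fun r => ?_
  simp only [slope_def_module]
  rw [← Complex.coe_smul (r - t)⁻¹ (x r - x t), ← Complex.coe_smul (r - t)⁻¹ (y r - y t),
    map_smul, inner_smul_left, inner_smul_right, Complex.real_smul, Complex.real_smul,
    Complex.conj_ofReal, inner_sub_left, map_sub, inner_sub_right]
  ring

variable [CompleteSpace K]

/-- A weakly bounded family of bounded operators is norm bounded. -/
theorem exists_norm_le_of_inner_bounded {ι : Type*} {σ : ι → K →L[ℂ] K}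
    (h : ∀ x y, ∃ C, ∀ i, ‖⟪x, σ i y⟫_ℂ‖ ≤ C) : ∃ C, ∀ i, ‖σ i‖ ≤ C := by
  refine banach_steinhaus fun y => ?_
  obtain ⟨C, hC⟩ := banach_steinhaus (g := fun i => innerSL ℂ (σ i y)) fun x => by
    obtain ⟨C, hC⟩ := h x y
    refine ⟨C, fun i => ?_⟩
    rw [innerSL_apply_apply, norm_inner_symm]
    exact hC i
  exact ⟨C, fun i => by simpa using hC i⟩

variable {ħ : ℝ} {H : K →ₗ.[ℂ] K} {U : ℝ → K →L[ℂ] K}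

/-- The von Neumann equation, read weakly on domain vectors, has only the zero solution with zero
initial value. Sandwiching with the resolvent `R = (H + i)⁻¹` makes `σ = R† δ R` norm bounded and
its matrix elements between domain vectors continuously differentiable, whence
`⟪U(t) φ, σ(t) U(t) ψ⟫` is constant. -/
theorem eq_zero_of_vonNeumann (hħ : ħ ≠ 0) (hH : IsSelfAdjoint H)
    (hU : IsSchrodingerGroup ħ H U) {T : ℝ} (hT : 0 ≤ T) {δ : ℝ → K →L[ℂ] K}
    (hint : ∀ φ ψ : H.domain, IntervalIntegrable
      (fun s => ⟪H φ, δ s (ψ : K)⟫_ℂ - ⟪(φ : K), δ s (H ψ)⟫_ℂ) MeasureTheory.volume 0 T)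
    (heq : ∀ φ ψ : H.domain, ∀ t ∈ Set.Icc 0 T, ⟪(φ : K), δ t (ψ : K)⟫_ℂ
      = -(Complex.I / (ħ : ℂ)) *
        ∫ s in (0 : ℝ)..t, (⟪H φ, δ s (ψ : K)⟫_ℂ - ⟪(φ : K), δ s (H ψ)⟫_ℂ)) :
    δ T = 0 := by
  obtain ⟨R, -, hR1, hR2⟩ := exists_resolvent hH one_ne_zero
  have hRmem : ∀ y, R y ∈ H.domain := fun y => (hR1 y).1
  have hRH : ∀ x : H.domain, H ⟨R x, hRmem x⟩ = R (H x) := fun x => by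
    have h1 := hR2 x
    have h2 := (hR1 x).2
    rw [map_add, map_smul] at h1
    exact add_right_cancel (h2.trans h1.symm)
  have hcont : ∀ φ ψ : H.domain,
      ContinuousOn (fun t => ⟪(φ : K), δ t (ψ : K)⟫_ℂ) (Set.Icc 0 T) := fun φ ψ => by
    have h := intervalIntegral.continuousOn_primitive_interval' (hint φ ψ) Set.left_mem_uIcc
    rw [Set.uIcc_of_le hT] at h
    exact (continuousOn_const.mul h).congr (heq φ ψ)
  let σ : ℝ → K →L[ℂ] K := fun t => star R * δ t * R
  have hσ : ∀ t x y, ⟪x, σ t y⟫_ℂ = ⟪R x, δ t (R y)⟫_ℂ := fun t x y => inner_star_right R _ _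
  have hσc : ∀ x y, ContinuousOn (fun t => ⟪x, σ t y⟫_ℂ) (Set.Icc 0 T) := fun x y => by
    simp only [hσ]
    exact hcont ⟨R x, hRmem x⟩ ⟨R y, hRmem y⟩
  obtain ⟨C, hC⟩ := exists_norm_le_of_inner_bounded (σ := fun t : Set.Icc 0 T => σ t)
    fun x y => by
      obtain ⟨C, hC⟩ := isCompact_Icc.exists_bound_of_continuousOn (hσc x y)
      exact ⟨C, fun t => hC t t.2⟩
  -- `R` commutes with `H`, so the right-hand side only involves the weakly continuous `σ`
  have hσd : ∀ φ ψ : H.domain, ∀ t ∈ Set.Icc 0 T,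
      HasDerivWithinAt (fun t => ⟪(φ : K), σ t (ψ : K)⟫_ℂ) (-(Complex.I / (ħ : ℂ)) *
        (⟪H φ, σ t (ψ : K)⟫_ℂ - ⟪(φ : K), σ t (H ψ)⟫_ℂ)) (Set.Icc 0 T) t := by
    intro φ ψ t ht
    have hc : ContinuousOn (fun s => ⟪H φ, σ s (ψ : K)⟫_ℂ - ⟪(φ : K), σ s (H ψ)⟫_ℂ)
        (Set.Icc 0 T) := (hσc _ _).sub (hσc _ _)
    have : Fact (t ∈ Set.Icc 0 T) := ⟨ht⟩
    have h := intervalIntegral.integral_hasDerivWithinAt_right (a := 0) (b := t)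
      (s := Set.Icc 0 T) (t := Set.Icc 0 T)
      ((hc.mono (Set.Icc_subset_Icc_right ht.2)).intervalIntegrable_of_Icc ht.1)
      (hc.stronglyMeasurableAtFilter_nhdsWithin measurableSet_Icc t) (hc t ht)
    have e : ∀ s ∈ Set.Icc 0 T, ⟪(φ : K), σ s (ψ : K)⟫_ℂ = -(Complex.I / (ħ : ℂ)) *
        ∫ r in (0 : ℝ)..s, (⟪H φ, σ r (ψ : K)⟫_ℂ - ⟪(φ : K), σ r (H ψ)⟫_ℂ) := by
      intro s hs
      simp only [hσ]
      rw [heq ⟨R φ, hRmem φ⟩ ⟨R ψ, hRmem ψ⟩ s hs, hRH, hRH]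
    exact (h.const_mul _).congr e (e t ht)
  have hzero : ∀ φ ψ : H.domain, ⟪U T (φ : K), σ T (U T (ψ : K))⟫_ℂ = 0 := by
    intro φ ψ
    have hf : ∀ t ∈ Set.Icc 0 T, HasDerivWithinAt
        (fun t => ⟪U t (φ : K), σ t (U t (ψ : K))⟫_ℂ) 0 (Set.Icc 0 T) t := by
      intro t ht
      obtain ⟨hφ, hφ'⟩ := hU.exists_apply_mem hħ φ t
      obtain ⟨hψ, hψ'⟩ := hU.exists_apply_mem hħ ψ t
      have h := hasDerivWithinAt_inner_apply (fun r hr => hC ⟨r, hr⟩)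
        (fun u v => hσc u v t ht) (hU.hasDerivAt_apply φ t).hasDerivWithinAt
        (hU.hasDerivAt_apply ψ t).hasDerivWithinAt (hσd ⟨_, hφ⟩ ⟨_, hψ⟩ t ht)
      refine h.congr_deriv ?_
      rw [hφ', hψ']
      simp [inner_smul_left, inner_smul_right]
      ring
    have h0 : ⟪(φ : K), σ 0 (ψ : K)⟫_ℂ = 0 := by
      rw [hσ, heq ⟨R φ, hRmem φ⟩ ⟨R ψ, hRmem ψ⟩ 0 ⟨le_rfl, hT⟩]
      simp
    have h1 := constant_of_derivWithin_zero (fun t ht => (hf t ht).differentiableWithinAt)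
      (fun t ht => (hf t (Set.Ico_subset_Icc_self ht)).derivWithin
        (uniqueDiffOn_Icc (ht.1.trans_lt ht.2) t (Set.Ico_subset_Icc_self ht))) T ⟨hT, le_rfl⟩
    simpa [hU.zero, h0] using h1
  -- every domain vector has the form `U(T) φ` with `φ` in the domain
  have hσT : σ T = 0 := eq_zero_of_inner_eq_zero hH.dense_domain fun x hx y hy => by
    have h := hzero ⟨_, (hU.exists_apply_mem hħ ⟨x, hx⟩ (-T)).1⟩
      ⟨_, (hU.exists_apply_mem hħ ⟨y, hy⟩ (-T)).1⟩
    simpa only [hU.apply_neg_apply] using h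
  -- every domain vector is in the range of `R`
  refine eq_zero_of_inner_eq_zero hH.dense_domain fun x hx y hy => ?_
  have h := hσ T (H ⟨x, hx⟩ + (Complex.I * (1 : ℝ)) • x) (H ⟨y, hy⟩ + (Complex.I * (1 : ℝ)) • y)
  rw [hR2 ⟨x, hx⟩, hR2 ⟨y, hy⟩, hσT] at h
  simpa using h.symm

end Uniqueness

/-! ### Counting scatterings and labelling them by particles -/

section Counting

variable {Λ : Type*} (υ : Trajectory Λ)

theorem Trajectory.mem_timesBefore {t r : ℝ} :
    r ∈ υ.timesBefore t ↔ r ∈ Set.range υ.time ∧ r < t := by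
  rw [Trajectory.timesBefore, Set.Finite.mem_toFinset]; rfl

theorem Trajectory.exists_lt_iff (t : ℝ) : ∃ N, ∀ n, υ.time n < t ↔ n < N := by
  classical
  have hex : ∃ n, ¬ υ.time n < t := by
    by_contra! h
    refine Set.infinite_range_of_injective υ.time_strictMono.injective
      ((υ.finite_before t).subset ?_)
    rintro _ ⟨n, rfl⟩
    exact ⟨⟨n, rfl⟩, h n⟩
  refine ⟨Nat.find hex, fun n => ⟨fun h => ?_, fun h => not_not.1 (Nat.find_min hex h)⟩⟩
  by_contra hn
  exact Nat.find_spec hex ((υ.time_strictMono.monotone (not_lt.1 hn)).trans_lt h)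

theorem Trajectory.timesBefore_eq {t : ℝ} {N : ℕ} (hN : ∀ n, υ.time n < t ↔ n < N) :
    υ.timesBefore t = (Finset.range N).image υ.time := by
  ext r
  rw [υ.mem_timesBefore, Finset.mem_image]
  constructor
  · rintro ⟨⟨n, rfl⟩, h⟩
    exact ⟨n, Finset.mem_range.2 ((hN n).1 h), rfl⟩
  · rintro ⟨n, hn, rfl⟩
    exact ⟨⟨n, rfl⟩, (hN n).2 (Finset.mem_range.1 hn)⟩

/-- The scatterings before `t` are those with the numbers below `n_t`. -/
theorem Trajectory.lt_count_iff {n : ℕ} {t : ℝ} : n < υ.count t ↔ υ.time n < t := by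
  obtain ⟨N, hN⟩ := υ.exists_lt_iff t
  rw [Trajectory.count, υ.timesBefore_eq hN,
    Finset.card_image_of_injective _ υ.time_strictMono.injective, Finset.card_range, hN]

theorem Trajectory.timesBefore_eq_image (t : ℝ) :
    υ.timesBefore t = (Finset.range (υ.count t)).image υ.time :=
  υ.timesBefore_eq fun _ => υ.lt_count_iff.symm

theorem Trajectory.count_time (n : ℕ) : υ.count (υ.time n) = n := by
  refine le_antisymm (not_lt.1 fun h => ?_) (not_lt.1 fun h => ?_)
  · exact lt_irrefl _ (υ.lt_count_iff.1 h)
  · exact (lt_irrefl _ (υ.lt_count_iff.2 (υ.time_strictMono h)))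

theorem Trajectory.count_mono : Monotone υ.count := fun s t hst => by
  by_contra! h
  exact lt_irrefl _ (υ.lt_count_iff.2 ((υ.lt_count_iff.1 h).trans_le hst))

theorem Trajectory.count_zero : υ.count 0 = 0 := by
  by_contra h
  exact absurd (υ.lt_count_iff.1 (Nat.pos_of_ne_zero h)) (not_lt.2 (υ.time_nonneg 0))

variable {M : ℕ}

open Classical in
/-- The partition of the times `a 0, …, a (N - 1)` into the fibres of a labelling `κ`. -/
def labelPartition (a : ℕ → ℝ) {N : ℕ} (κ : Fin N → Fin M) : Fin M → Finset ℝ :=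
  fun k => (Finset.univ.filter fun i => κ i = k).image fun i => a i

theorem mem_labelPartition {a : ℕ → ℝ} {N : ℕ} {κ : Fin N → Fin M} {k : Fin M} {r : ℝ} :
    r ∈ labelPartition a κ k ↔ ∃ i, κ i = k ∧ a i = r := by
  simp [labelPartition]

theorem apply_mem_labelPartition {a : ℕ → ℝ} (ha : Function.Injective a) {N : ℕ}
    {κ : Fin N → Fin M} {k : Fin M} {i : Fin N} : a i ∈ labelPartition a κ k ↔ κ i = k := by
  rw [mem_labelPartition]
  constructor
  · rintro ⟨j, hj, hji⟩
    rwa [← Fin.ext (ha hji)]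
  · exact fun h => ⟨i, h, rfl⟩

theorem mem_partitions {τ : Finset ℝ} {σ : Fin M → Finset ℝ} :
    σ ∈ partitions M τ ↔ (∀ k l, k ≠ l → Disjoint (σ k) (σ l)) ∧
      ∀ r, r ∈ τ ↔ ∃ k, r ∈ σ k := by
  classical
  simp only [partitions, Finset.mem_filter, Fintype.mem_piFinset, Finset.mem_powerset]
  constructor
  · rintro ⟨-, h1, rfl⟩
    exact ⟨h1, fun r => by simp⟩
  · rintro ⟨h1, h2⟩
    refine ⟨fun k r hr => (h2 r).2 ⟨k, hr⟩, h1, ?_⟩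
    ext r
    simp [h2]

/-- Summing over the partitions of `N` times is summing over the labellings of the numbers
`0, …, N - 1` by particles. -/
theorem sum_partitions {β : Type*} [AddCommMonoid β] {a : ℕ → ℝ} (ha : Function.Injective a)
    (N : ℕ) (f : (Fin M → Finset ℝ) → β) :
    ∑ σ ∈ partitions M ((Finset.range N).image a), f σ
      = ∑ κ : Fin N → Fin M, f (labelPartition a κ) := by
  symm
  refine Finset.sum_nbij (labelPartition a) (fun κ _ => ?_) (fun κ _ κ' _ h => ?_)
    (fun σ hσ => ?_) fun _ _ => rfl
  · refine mem_partitions.2 ⟨fun k l hkl => Finset.disjoint_left.2 fun r h1 h2 => ?_, fun r => ?_⟩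
    · obtain ⟨i, rfl, rfl⟩ := mem_labelPartition.1 h1
      exact hkl ((apply_mem_labelPartition ha).1 h2)
    · simp only [mem_labelPartition, Finset.mem_image, Finset.mem_range]
      constructor
      · rintro ⟨n, hn, rfl⟩
        exact ⟨_, ⟨n, hn⟩, rfl, rfl⟩
      · rintro ⟨_, i, -, rfl⟩
        exact ⟨i, i.2, rfl⟩
  · funext i
    have h1 : a i ∈ labelPartition a κ' (κ i) := h ▸ (apply_mem_labelPartition ha).2 rfl
    exact ((apply_mem_labelPartition ha).1 h1).symm
  · obtain ⟨h1, h2⟩ := mem_partitions.1 (Finset.mem_coe.1 hσ)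
    have h3 : ∀ i : Fin N, ∃ k, a i ∈ σ k := fun i =>
      (h2 _).1 (Finset.mem_image_of_mem _ (Finset.mem_range.2 i.2))
    choose κ hκ using h3
    refine ⟨κ, Finset.mem_coe.2 (Finset.mem_univ _), funext fun k => Finset.ext fun r => ?_⟩
    rw [mem_labelPartition]
    constructor
    · rintro ⟨i, rfl, rfl⟩
      exact hκ i
    · intro hr
      obtain ⟨n, hn, rfl⟩ := Finset.mem_image.1 ((h2 r).2 ⟨k, hr⟩)
      refine ⟨⟨n, Finset.mem_range.1 hn⟩, ?_, rfl⟩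
      by_contra hne
      exact Finset.disjoint_left.1 (h1 _ _ hne) (hκ _) hr

end Counting

/-! ### Averages over labellings -/

section Averages

variable {M : ℕ} {R : Type*} [Ring R]

/-- The word `A (κ 0) 0 * A (κ 1) 1 * ⋯ * A (κ (N - 1)) (N - 1)` spelled by a labelling `κ`. -/
def labelWord (A : Fin M → ℕ → R) {N : ℕ} (κ : Fin N → Fin M) : R :=
  (List.ofFn fun i : Fin N => A (κ i) i).prod

theorem labelWord_snoc (A : Fin M → ℕ → R) {N : ℕ} (κ : Fin N → Fin M) (k : Fin M) :
    labelWord A (Fin.snoc κ k : Fin (N + 1) → Fin M) = labelWord A κ * A k N := by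
  rw [labelWord, List.ofFn_succ', List.concat_eq_append, List.prod_append]
  simp [labelWord]

theorem sum_labelling_succ {β : Type*} [AddCommMonoid β] (N : ℕ)
    (f : (Fin (N + 1) → Fin M) → β) :
    ∑ κ, f κ = ∑ k, ∑ κ : Fin N → Fin M, f (Fin.snoc κ k) := by
  rw [← (Fin.snocEquiv fun _ => Fin M).sum_comp, Fintype.sum_prod_type]
  rfl

variable [Algebra ℂ R] [StarRing R]

/-- The average of `W X W†` over the words `W` spelled by the labellings. -/
def averageConj (A : Fin M → ℕ → R) (N : ℕ) (X : R) : R :=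
  ((M : ℂ) ^ N)⁻¹ • ∑ κ : Fin N → Fin M, labelWord A κ * X * star (labelWord A κ)

/-- The average of `W† X W` over the words `W` spelled by the labellings. -/
def averageConjStar (A : Fin M → ℕ → R) (N : ℕ) (X : R) : R :=
  ((M : ℂ) ^ N)⁻¹ • ∑ κ : Fin N → Fin M, star (labelWord A κ) * X * labelWord A κ

theorem averageConj_zero (A : Fin M → ℕ → R) (X : R) : averageConj A 0 X = X := by
  simp [averageConj, labelWord]

theorem averageConjStar_zero (A : Fin M → ℕ → R) (X : R) : averageConjStar A 0 X = X := by
  simp [averageConjStar, labelWord]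

theorem averageConj_succ (A : Fin M → ℕ → R) (N : ℕ) (X : R) :
    averageConj A (N + 1) X
      = averageConj A N ((M : ℂ)⁻¹ • ∑ k, A k N * X * star (A k N)) := by
  rw [averageConj, averageConj, sum_labelling_succ, Finset.sum_comm, pow_succ, mul_inv,
    mul_smul, Finset.smul_sum (r := (M : ℂ)⁻¹)]
  congr 1
  refine Finset.sum_congr rfl fun κ _ => ?_
  rw [mul_smul_comm, smul_mul_assoc, Finset.mul_sum, Finset.sum_mul]
  congr 1
  refine Finset.sum_congr rfl fun k _ => ?_
  rw [labelWord_snoc, star_mul]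
  simp only [mul_assoc]

theorem averageConjStar_succ (A : Fin M → ℕ → R) (N : ℕ) (X : R) :
    averageConjStar A (N + 1) X
      = (M : ℂ)⁻¹ • ∑ k, star (A k N) * averageConjStar A N X * A k N := by
  rw [averageConjStar, sum_labelling_succ, pow_succ', mul_inv, mul_smul, Finset.smul_sum]
  congr 1
  refine Finset.sum_congr rfl fun k _ => ?_
  rw [averageConjStar, mul_smul_comm, smul_mul_assoc, Finset.mul_sum, Finset.sum_mul]
  congr 1
  refine Finset.sum_congr rfl fun κ _ => ?_
  rw [labelWord_snoc, star_mul]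
  simp only [mul_assoc]

end Averages

/-! ### The reduction and the a posteriori density operator as averages over labellings -/

section Labelled

variable {Λ E : Type*} [NormedAddCommGroup E] [InnerProductSpace ℂ E] {M : ℕ}
  (U : ℝ → TensorPower M E →L[ℂ] TensorPower M E) (G : Λ → E →L[ℂ] E) (υ : Trajectory Λ)

/-- The factor `G(k, tₙ, yₙ)†` of the chronological products, as a letter indexed by the particle
and the number of the scattering. -/
def scatteringLetter (k : Fin M) (n : ℕ) : TensorPower M E →L[ℂ] TensorPower M E :=
  star (heisenbergReduction U G k (υ.time n) (υ.mark n))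

theorem chronologicalProduct_labelPartition (t : ℝ) (κ : Fin (υ.count t) → Fin M) :
    chronologicalProduct U G υ t (labelPartition υ.time κ)
      = labelWord (scatteringLetter U G υ) κ := by
  rw [chronologicalProduct, labelWord, ← List.map_coe_finRange_eq_range, List.map_map,
    List.ofFn_eq_map]
  congr 1
  refine List.map_congr_left fun i _ => ?_
  simp only [Function.comp_apply, scatteringFactor, scatteringLetter,
    apply_mem_labelPartition υ.time_strictMono.injective]
  rw [Finset.sum_filter, Finset.sum_ite_eq]
  simp

theorem reduction_eq_averageConj (t : ℝ) (X : TensorPower M E →L[ℂ] TensorPower M E) :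
    reduction U G υ t X = averageConj (scatteringLetter U G υ) (υ.count t) X := by
  rw [reduction, averageConj, υ.timesBefore_eq_image,
    sum_partitions υ.time_strictMono.injective]
  simp only [chronologicalProduct_labelPartition]

/-- The average over the partitions is the chronological composition of single mixing
reductions. -/
theorem reduction_eq_mixingComposition (t : ℝ)
    (X : TensorPower M E →L[ℂ] TensorPower M E) :
    reduction U G υ t X = mixingComposition U G υ t X := by
  rw [reduction_eq_averageConj, mixingComposition]
  generalize υ.count t = N
  induction N generalizing X with
  | zero => simp [averageConj_zero]
  | succ N ih =>
    rw [averageConj_succ, ih, List.range_succ, List.foldr_append]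
    simp [mixingReduction, scatteringLetter]

/-- `ρ(t)` in the interaction picture depends on `t` only through `n_t`. -/
theorem posteriorDensity_eq_averageConjStar (ρ₀ : TensorPower M E →L[ℂ] TensorPower M E)
    (t : ℝ) : posteriorDensity U G ρ₀ υ t
      = U t * averageConjStar (scatteringLetter U G υ) (υ.count t) ρ₀ * star (U t) := by
  rw [posteriorDensity, averageConjStar, υ.timesBefore_eq_image,
    sum_partitions υ.time_strictMono.injective, mul_smul_comm, smul_mul_assoc, Finset.mul_sum,
    Finset.sum_mul]
  congr 1
  refine Finset.sum_congr rfl fun κ _ => ?_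
  rw [propagator, chronologicalProduct_labelPartition, star_mul, star_star]
  simp only [mul_assoc]

end Labelled

/-! ### The differential and the integral form of the evolution equation -/

section Equation

variable {K : Type*} [NormedAddCommGroup K] [InnerProductSpace ℂ K] [CompleteSpace K]

/-- The integrated von Neumann equation for `U(s) A U(s)†`. -/
theorem IsSchrodingerGroup.integral_conj {ħ : ℝ} {H : K →ₗ.[ℂ] K} {U : ℝ → K →L[ℂ] K}
    (hU : IsSchrodingerGroup ħ H U) (A : K →L[ℂ] K) (φ ψ : H.domain) (a : ℝ) :
    Complex.I / (ħ : ℂ) * (∫ s in (0 : ℝ)..a, (⟪H φ, (U s * A * star (U s)) (ψ : K)⟫_ℂ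
        - ⟪(φ : K), (U s * A * star (U s)) (H ψ)⟫_ℂ))
      = ⟪(φ : K), A (ψ : K)⟫_ℂ - ⟪(φ : K), (U a * A * star (U a)) (ψ : K)⟫_ℂ := by
  have hc : Continuous fun s => -(Complex.I / (ħ : ℂ)) *
      (⟪H φ, (U s * A * star (U s)) (ψ : K)⟫_ℂ
        - ⟪(φ : K), (U s * A * star (U s)) (H ψ)⟫_ℂ) :=
    continuous_const.mul ((hU.continuous_inner_conj A _ _).sub (hU.continuous_inner_conj A _ _))
  have h := intervalIntegral.integral_eq_sub_of_hasDerivAt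
    (fun s _ => hU.hasDerivAt_inner_conj A φ ψ s) (hc.intervalIntegrable 0 a)
  rw [intervalIntegral.integral_const_mul] at h
  have h0 : U 0 * A * star (U 0) = A := by simp [hU.zero]
  rw [h0] at h
  linear_combination -h

variable {Λ E : Type*} [NormedAddCommGroup E] [InnerProductSpace ℂ E] {M : ℕ}
  {ħ : ℝ} {H : TensorPower M E →ₗ.[ℂ] TensorPower M E}
  {U : ℝ → TensorPower M E →L[ℂ] TensorPower M E} {G : Λ → E →L[ℂ] E} {υ : Trajectory Λ}
  {ρ₀ : TensorPower M E →L[ℂ] TensorPower M E}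

/-- In the interaction picture the jump at a scattering is one step of the average. At `tₙ` itself
only the `n` earlier scatterings are counted. -/
theorem densityJump_posteriorDensity (hU : IsSchrodingerGroup ħ H U) (n : ℕ) :
    densityJump G (υ.mark n) (posteriorDensity U G ρ₀ υ (υ.time n))
      = U (υ.time n) * (averageConjStar (scatteringLetter U G υ) (n + 1) ρ₀
          - averageConjStar (scatteringLetter U G υ) n ρ₀) * star (U (υ.time n)) := by
  have hUU : ∀ X, U (υ.time n) * (star (U (υ.time n)) * X) = X := fun X => by
    rw [← mul_assoc, (Unitary.mem_iff.1 (hU.unitary _)).2, one_mul]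
  rw [densityJump, posteriorDensity_eq_averageConjStar, υ.count_time, mul_sub, sub_mul,
    averageConjStar_succ, mul_smul_comm, smul_mul_assoc, Finset.mul_sum, Finset.sum_mul]
  congr 2
  refine Finset.sum_congr rfl fun k _ => ?_
  simp only [scatteringLetter, heisenbergReduction, star_mul, star_star, mul_assoc, hUU,
    (Unitary.mem_iff.1 (hU.unitary _)).2, mul_one]

/-- The contributions of the scatterings, transported to the interaction picture, telescope. -/
theorem isIntegralSolution_posteriorDensity (hU : IsSchrodingerGroup ħ H U) :
    IsIntegralSolution U G ρ₀ υ (posteriorDensity U G ρ₀ υ) := by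
  intro t _
  have hterm : ∀ n, U (t - υ.time n)
      * densityJump G (υ.mark n) (posteriorDensity U G ρ₀ υ (υ.time n))
      * star (U (t - υ.time n))
      = U t * (averageConjStar (scatteringLetter U G υ) (n + 1) ρ₀
          - averageConjStar (scatteringLetter U G υ) n ρ₀) * star (U t) := fun n => by
    have h : U t = U (t - υ.time n) * U (υ.time n) := by rw [← hU.add, sub_add_cancel]
    rw [densityJump_posteriorDensity hU, h, star_mul]
    simp only [mul_assoc]
  simp only [hterm]
  rw [← Finset.sum_mul, ← Finset.mul_sum,
    Finset.sum_range_sub fun n => averageConjStar (scatteringLetter U G υ) n ρ₀,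
    averageConjStar_zero,
    posteriorDensity_eq_averageConjStar, mul_sub, sub_mul, add_sub_cancel]

/-- A solution of the integral equation solves the differential equation: between scatterings each
summand satisfies the von Neumann equation. -/
theorem IsIntegralSolution.isSolution (hU : IsSchrodingerGroup ħ H U)
    {ρ : ℝ → TensorPower M E →L[ℂ] TensorPower M E} (h : IsIntegralSolution U G ρ₀ υ ρ) :
    IsSolution ħ H G ρ₀ υ ρ := by
  have key : ∀ (φ ψ : H.domain) (t : ℝ), 0 ≤ t →
      IntervalIntegrable (fun s => ⟪H φ, ρ s (ψ : TensorPower M E)⟫_ℂ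
        - ⟪(φ : TensorPower M E), ρ s (H ψ)⟫_ℂ) MeasureTheory.volume 0 t ∧
      ⟪(φ : TensorPower M E), ρ t (ψ : TensorPower M E)⟫_ℂ
          - ⟪(φ : TensorPower M E), ρ₀ (ψ : TensorPower M E)⟫_ℂ
        + Complex.I / (ħ : ℂ) * (∫ s in (0 : ℝ)..t,
            (⟪H φ, ρ s (ψ : TensorPower M E)⟫_ℂ - ⟪(φ : TensorPower M E), ρ s (H ψ)⟫_ℂ))
        = ∑ n ∈ Finset.range (υ.count t), ⟪(φ : TensorPower M E),
            densityJump G (υ.mark n) (ρ (υ.time n)) (ψ : TensorPower M E)⟫_ℂ := by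
    intro φ ψ t ht
    -- the jumps `J n`, the integrand `D A` for `U(s) A U(s)†`, and the contribution `I n` of the
    -- `n`-th scattering to the integrand, switched on after `tₙ`
    let J : ℕ → TensorPower M E →L[ℂ] TensorPower M E :=
      fun n => densityJump G (υ.mark n) (ρ (υ.time n))
    let D : (TensorPower M E →L[ℂ] TensorPower M E) → ℝ → ℂ := fun A s =>
      ⟪H φ, (U s * A * star (U s)) (ψ : TensorPower M E)⟫_ℂ
        - ⟪(φ : TensorPower M E), (U s * A * star (U s)) (H ψ)⟫_ℂ
    have hD : ∀ A, Continuous (D A) := fun A =>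
      (hU.continuous_inner_conj A _ _).sub (hU.continuous_inner_conj A _ _)
    let I : ℕ → ℝ → ℂ := fun n =>
      (Set.Ioi (υ.time n)).indicator fun s => D (J n) (s - υ.time n)
    have hI : ∀ n, IntervalIntegrable (I n) MeasureTheory.volume 0 t := fun n => by
      have hc : Continuous fun s => D (J n) (s - υ.time n) :=
        (hD (J n)).comp (continuous_id.sub continuous_const)
      have h1 := hc.intervalIntegrable (μ := MeasureTheory.volume) 0 t
      rw [intervalIntegrable_iff] at h1 ⊢
      exact h1.indicator measurableSet_Ioi
    have hF : ∀ s ∈ Set.uIoc 0 t, D ρ₀ s + ∑ n ∈ Finset.range (υ.count t), I n s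
        = ⟪H φ, ρ s (ψ : TensorPower M E)⟫_ℂ - ⟪(φ : TensorPower M E), ρ s (H ψ)⟫_ℂ := by
      intro s hs
      rw [Set.uIoc_of_le ht] at hs
      have hsub : ∑ n ∈ Finset.range (υ.count t), I n s
          = ∑ n ∈ Finset.range (υ.count s), D (J n) (s - υ.time n) := by
        rw [← Finset.sum_subset (Finset.range_mono (υ.count_mono hs.2)) fun n _ hn => ?_]
        · refine Finset.sum_congr rfl fun n hn => Set.indicator_of_mem ?_ _
          exact υ.lt_count_iff.1 (Finset.mem_range.1 hn)
        · refine Set.indicator_of_notMem (fun hmem => hn ?_) _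
          exact Finset.mem_range.2 (υ.lt_count_iff.2 hmem)
      rw [hsub, h s hs.1.le]
      simp only [add_apply, sum_apply, inner_add_right, inner_sum, D, J,
        Finset.sum_sub_distrib]
      ring
    have hsum : IntervalIntegrable (fun s => ∑ n ∈ Finset.range (υ.count t), I n s)
        MeasureTheory.volume 0 t := by
      have h1 := IntervalIntegrable.sum (Finset.range (υ.count t)) fun n _ => hI n
      simpa only [Finset.sum_fn] using h1
    have hD0 := (hD ρ₀).intervalIntegrable (μ := MeasureTheory.volume) 0 t
    refine ⟨(hD0.add hsum).congr hF, ?_⟩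
    have hint : ∀ n ∈ Finset.range (υ.count t), ∫ s in (0 : ℝ)..t, I n s
        = ∫ s in (0 : ℝ)..(t - υ.time n), D (J n) s := by
      intro n hn
      have hlt := υ.lt_count_iff.1 (Finset.mem_range.1 hn)
      have h1 := intervalIntegral.integral_comp_sub_right (a := υ.time n) (b := t) (D (J n))
        (υ.time n)
      rw [sub_self] at h1
      rw [← h1, intervalIntegral.integral_of_le ht, intervalIntegral.integral_of_le hlt.le,
        MeasureTheory.setIntegral_indicator measurableSet_Ioi]
      congr 2
      ext s
      simp only [Set.mem_inter_iff, Set.mem_Ioc, Set.mem_Ioi]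
      have := υ.time_nonneg n
      constructor
      · rintro ⟨⟨-, h2⟩, h3⟩
        exact ⟨h3, h2⟩
      · rintro ⟨h2, h3⟩
        exact ⟨⟨this.trans_lt h2, h3⟩, h2⟩
    rw [← intervalIntegral.integral_congr_ae (Filter.Eventually.of_forall hF),
      intervalIntegral.integral_add hD0 hsum,
      intervalIntegral.integral_finsetSum fun n _ => hI n, Finset.sum_congr rfl hint, mul_add,
      Finset.mul_sum, hU.integral_conj,
      Finset.sum_congr rfl fun n _ => hU.integral_conj (J n) φ ψ (t - υ.time n), h t ht]
    simp only [add_apply, sum_apply, inner_add_right, inner_sum, J, Finset.sum_sub_distrib]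
    ring
  refine ⟨?_, fun φ ψ t ht => (key φ ψ t ht).1, fun φ ψ t ht => (key φ ψ t ht).2⟩
  rw [h 0 le_rfl, υ.count_zero]
  simp [hU.zero]

/-- Two solutions of the differential equation agree: by induction on the number of scatterings
their jumps agree, and then their difference solves the von Neumann equation with initial value
zero. -/
theorem IsSolution.unique (hħ : ħ ≠ 0) (hH : IsSelfAdjoint H) (hU : IsSchrodingerGroup ħ H U)
    {ρ ρ' : ℝ → TensorPower M E →L[ℂ] TensorPower M E} (h : IsSolution ħ H G ρ₀ υ ρ)
    (h' : IsSolution ħ H G ρ₀ υ ρ') (t : ℝ) (ht : 0 ≤ t) : ρ t = ρ' t := by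
  induction hN : υ.count t using Nat.strong_induction_on generalizing t with
  | _ N ih =>
    have hsub : ∀ (φ ψ : H.domain) (s : ℝ),
        ⟪H φ, (ρ s - ρ' s) (ψ : TensorPower M E)⟫_ℂ
          - ⟪(φ : TensorPower M E), (ρ s - ρ' s) (H ψ)⟫_ℂ
        = (⟪H φ, ρ s (ψ : TensorPower M E)⟫_ℂ - ⟪(φ : TensorPower M E), ρ s (H ψ)⟫_ℂ)
          - (⟪H φ, ρ' s (ψ : TensorPower M E)⟫_ℂ - ⟪(φ : TensorPower M E), ρ' s (H ψ)⟫_ℂ) := by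
      intro φ ψ s
      simp only [sub_apply, inner_sub_right]
      ring
    refine sub_eq_zero.1 (eq_zero_of_vonNeumann hħ hH hU ht (δ := fun s => ρ s - ρ' s)
      (fun φ ψ => ?_) fun φ ψ s hs => ?_)
    · simp only [hsub]
      exact (h.integrable φ ψ t ht).sub (h'.integrable φ ψ t ht)
    · simp only [hsub]
      rw [intervalIntegral.integral_sub (h.integrable φ ψ s hs.1) (h'.integrable φ ψ s hs.1)]
      have hj : ∀ n ∈ Finset.range (υ.count s), ⟪(φ : TensorPower M E),
          densityJump G (υ.mark n) (ρ (υ.time n)) (ψ : TensorPower M E)⟫_ℂ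
          = ⟪(φ : TensorPower M E),
            densityJump G (υ.mark n) (ρ' (υ.time n)) (ψ : TensorPower M E)⟫_ℂ := by
        intro n hn
        rw [ih n (hN ▸ (Finset.mem_range.1 hn).trans_le (υ.count_mono hs.2)) _
          (υ.time_nonneg n) (υ.count_time n)]
      have e1 := h.equation φ ψ s hs.1
      have e2 := h'.equation φ ψ s hs.1
      rw [Finset.sum_congr rfl hj] at e1
      rw [sub_apply, inner_sub_right]
      linear_combination e1 - e2

end Equation

/-! ### The a posteriori density operator -/

section Density

variable {Λ E : Type*} [NormedAddCommGroup E] [InnerProductSpace ℂ E] {M : ℕ}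
  (U : ℝ → TensorPower M E →L[ℂ] TensorPower M E) (G : Λ → E →L[ℂ] E) (υ : Trajectory Λ)
  {ρ₀ : TensorPower M E →L[ℂ] TensorPower M E}

theorem isPositive_posteriorDensity (h : ρ₀.IsPositive) (t : ℝ) :
    (posteriorDensity U G ρ₀ υ t).IsPositive := by
  have h0 : 0 ≤ ρ₀ := (ContinuousLinearMap.nonneg_iff_isPositive ρ₀).2 h
  rw [← ContinuousLinearMap.nonneg_iff_isPositive, posteriorDensity]
  have hM : ((M : ℂ) ^ υ.count t)⁻¹ = ((((M : ℝ) ^ υ.count t)⁻¹ : ℝ) : ℂ) := by push_cast; rfl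
  rw [hM, Complex.coe_smul]
  exact smul_nonneg (by positivity) (Finset.sum_nonneg fun σ _ => star_right_conjugate_nonneg h0 _)

/-- The duality `Tr (X ρ(t)) = Tr (Θ_t[X] ρ₀)`. -/
theorem exists_hasTrace_mul_posteriorDensity (h : IsDensityOperator ρ₀) (t : ℝ)
    (X : TensorPower M E →L[ℂ] TensorPower M E) :
    ∃ c, HasTrace (X * posteriorDensity U G ρ₀ υ t) c ∧
      HasTrace (reducedDynamics U G υ t X * ρ₀) c := by
  choose c h1 h2 using fun σ => exists_hasTrace_cyclic h.1 h.2
    (X * propagator U G υ t σ) (star (propagator U G υ t σ))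
  refine ⟨((M : ℂ) ^ υ.count t)⁻¹ * ∑ σ ∈ partitions M (υ.timesBefore t), c σ, ?_, ?_⟩
  · have e : X * posteriorDensity U G ρ₀ υ t
        = ((M : ℂ) ^ υ.count t)⁻¹ • ∑ σ ∈ partitions M (υ.timesBefore t),
          X * propagator U G υ t σ * ρ₀ * star (propagator U G υ t σ) := by
      rw [posteriorDensity, mul_smul_comm, Finset.mul_sum]
      simp only [mul_assoc]
    rw [e]
    exact (HasTrace.sum fun σ _ => h1 σ).smul _
  · have e : reducedDynamics U G υ t X * ρ₀
        = ((M : ℂ) ^ υ.count t)⁻¹ • ∑ σ ∈ partitions M (υ.timesBefore t),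
          star (propagator U G υ t σ) * (X * propagator U G υ t σ) * ρ₀ := by
      rw [reducedDynamics, reduction, smul_mul_assoc, Finset.sum_mul]
      simp only [propagator, star_mul, star_star, mul_assoc]
    rw [e]
    exact (HasTrace.sum fun σ _ => h2 σ).smul _

end Density

end MixingReduction

end

theorem theorem3 {E : Type*} [NormedAddCommGroup E] [InnerProductSpace ℂ E] [CompleteSpace E]
    {Λ : Type*} {M : ℕ} (hM : 0 < M) {ħ : ℝ} (hħ : 0 < ħ)
    (H : MixingReduction.TensorPower M E →ₗ.[ℂ] MixingReduction.TensorPower M E)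
    (hH : IsSelfAdjoint H) (G : Λ → E →L[ℂ] E)
    (ρ₀ : MixingReduction.TensorPower M E →L[ℂ] MixingReduction.TensorPower M E)
    (hρ₀ : MixingReduction.IsDensityOperator ρ₀)
    (υ : MixingReduction.Trajectory Λ) :
    let U := MixingReduction.schrodingerGroup ħ H
    let ρ := MixingReduction.posteriorDensity U G ρ₀ υ
    -- `ρ(t)` is a positive trace class operator, and it represents the reduced dynamics
    (∀ t : ℝ, 0 ≤ t → (ρ t).IsPositive ∧ ∃ c, MixingReduction.HasTrace (ρ t) c) ∧
    (∀ t : ℝ, 0 ≤ t → ∀ X : MixingReduction.TensorPower M E →L[ℂ] MixingReduction.TensorPower M E,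
      ∃ c, MixingReduction.HasTrace (X * ρ t) c ∧
        MixingReduction.HasTrace (MixingReduction.reducedDynamics U G υ t X * ρ₀) c) ∧
    -- the average over the partitions is the composition of the single mixing reductions
    (∀ t : ℝ, 0 ≤ t → ∀ X : MixingReduction.TensorPower M E →L[ℂ] MixingReduction.TensorPower M E,
      MixingReduction.reduction U G υ t X = MixingReduction.mixingComposition U G υ t X) ∧
    -- `ρ` is the unique solution of the equation
    MixingReduction.IsSolution ħ H G ρ₀ υ ρ ∧
    (∀ ρ' : ℝ → MixingReduction.TensorPower M E →L[ℂ] MixingReduction.TensorPower M E,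
      MixingReduction.IsSolution ħ H G ρ₀ υ ρ' → ∀ t : ℝ, 0 ≤ t → ρ' t = ρ t) ∧
    -- the differential and the integral form of the equation are equivalent
    (∀ ρ' : ℝ → MixingReduction.TensorPower M E →L[ℂ] MixingReduction.TensorPower M E,
      MixingReduction.IsSolution ħ H G ρ₀ υ ρ' ↔
        MixingReduction.IsIntegralSolution U G ρ₀ υ ρ') := by
  intro U ρ
  have hU : MixingReduction.IsSchrodingerGroup ħ H U :=
    MixingReduction.isSchrodingerGroup_schrodingerGroup hħ.ne' hH
  have hint : MixingReduction.IsIntegralSolution U G ρ₀ υ ρ :=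
    MixingReduction.isIntegralSolution_posteriorDensity hU
  have hsol : MixingReduction.IsSolution ħ H G ρ₀ υ ρ := hint.isSolution hU
  refine ⟨fun t _ => ⟨MixingReduction.isPositive_posteriorDensity U G υ hρ₀.1 t, ?_⟩,
    fun t _ X => MixingReduction.exists_hasTrace_mul_posteriorDensity U G υ hρ₀ t X,
    fun t _ X => MixingReduction.reduction_eq_mixingComposition U G υ t X, hsol,
    fun ρ' h' => h'.unique hħ.ne' hH hU hsol, fun ρ' => ⟨fun h' t ht => ?_,
      fun h' => h'.isSolution hU⟩⟩
  · obtain ⟨c, hc, -⟩ := MixingReduction.exists_hasTrace_mul_posteriorDensity U G υ hρ₀ t 1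
    exact ⟨c, by rwa [one_mul] at hc⟩
  · have heq : ∀ s, 0 ≤ s → ρ' s = ρ s := h'.unique hħ.ne' hH hU hsol
    rw [heq t ht, hint t ht]
    congr 1
    refine Finset.sum_congr rfl fun n _ => ?_
    rw [heq _ (υ.time_nonneg n)]
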